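/- Let $\mu\in(0,1)$, $\delta\in[\frac{\mu+1}{2},1)$ and $\varepsilon\in(0,\delta-\frac12)$. There exist exponents $\alpha=\alpha(\varepsilon,\delta)$, $\beta=\beta(\varepsilon,\delta)$ (depending only on $\mu,\varepsilon,\delta$) satisfying the inequalities listed below, such that the following holds. Let $p_1<p_2$ be real and let $u_0:\mathbb R\to\mathbb C$ have a Fourier transform $\mathcal F u_0$ (in the sense of tempered distributions, convention $\mathcal F\phi(p)=\int\phi(x)e^{-ixp}\,dx$) which is a function vanishing outside $[p_1,p_2]$, with $\mathcal F u_0(p)=(p-p_1)^{\mu-1}\tilde u(p)$ on $(p_1,p_2]$, where $\tilde u\in C^1([p_1,p_2],\mathbb C)$, $\tilde u(p_1)\neq0$, and $\mathcal F u_0(p_2)=0$. Let $u$ be the solution of $i\partial_tu+\partial_x^2u=0$ for $t>0$, $u(0,\cdot)=u_0$ (continuous on $[0,\infty)\times\mathbb R$, bounded on each strip $[0,T]\times\mathbb R$, the equation holding in the sense of tempered distributions in $x$). Put $T_{p_2}=(2(p_2-p_1))^{-1/\varepsilon}$, and, with $\tilde u$ extended by zero outside $[p_1,p_2]$, $$H(t,u_0)=\frac{e^{-i\pi/4}}{2\sqrt\pi}\,e^{it(p_1+t^{-\varepsilon})^2}\,\tilde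 u(p_1+t^{-\varepsilon}),\qquad K_\mu(t,u_0)=\frac{\Gamma(\mu)}{2^{\mu+1}\pi}\,e^{i\pi\mu/2}\,e^{it(p_1^2+2p_1t^{-\varepsilon})}\,\tilde u(p_1),$$ $$R_H=\frac{1}{2\sqrt\pi}\|\tilde u\|_{L^\infty(p_1,p_2)},\qquad R_K=\frac{\Gamma(\mu)}{2^{\mu+1}\pi}\|\tilde u\|_{L^\infty(p_1,p_2)}.$$ Then there are constants $R^{(1)},R^{(2)}\ge0$, independent of $t,x$, such that for all $(t,x)$ with $t>T_{p_2}$ and $\frac{x}{2t}-p_1=t^{-\varepsilon}$ one has $|H(t,u_0)|\le R_H$, $|K_\mu(t,u_0)|\le R_K$ and: * if $\mu>\frac12$: $\big|u(t,x)-H(t,u_0)\,t^{-\frac12+\varepsilon(1-\mu)}\big|\le R_K\,t^{-\mu+\varepsilon\mu}+R^{(1)}t^{-\alpha}+R^{(2)}t^{-\beta}$, where $-\alpha,\,-\beta,\,-\mu+\varepsilon\mu<-\frac12+\varepsilon(1-\mu)$; * if $\mu=\frac12$: $\big|u(t,x)-(K_\mu(t,u_0)+H(t,u_0))\,t^{-\frac12+\frac\varepsilon2}\big|\le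 R^{(1)}t^{-\alpha}+R^{(2)}t^{-\beta}$, where $-\alpha,-\beta<-\frac12+\frac\varepsilon2$; * if $\mu<\frac12$: $\big|u(t,x)-K_\mu(t,u_0)\,t^{-\mu+\varepsilon\mu}\big|\le R_H\,t^{-\frac12+\varepsilon(1-\mu)}+R^{(1)}t^{-\alpha}+R^{(2)}t^{-\beta}$, where $-\alpha,\,-\beta,\,-\frac12+\varepsilon(1-\mu)<-\mu+\varepsilon\mu$. Moreover these rates are attained: there are $c>0$ and $T'$ such that for all $(t,x)$ on the curve with $t\ge T'$, $|u(t,x)|\ge c\,t^{r}$, where $r=-\frac12+\varepsilon(1-\mu)$ if $\mu>\frac12$, $r=-\frac12+\frac\varepsilon2$ if $\mu=\frac12$, and $r=-\mu+\varepsilon\mu$ if $\mu<\frac12$. -/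

import Mathlib

noncomputable section

/-- `Fu₀` represents the Fourier transform of `u₀` in the sense of tempered distributions, with the
convention `𝓕 φ (x) = ∫ φ(p) e^{-ixp} dp`: `⟨u₀, 𝓕 φ⟩ = ⟨Fu₀, φ⟩` for all Schwartz functions `φ`. -/
def IsFourierTransformOf (Fu₀ u₀ : ℝ → ℂ) : Prop :=
  ∀ φ : SchwartzMap ℝ ℂ,
    MeasureTheory.Integrable
      (fun x : ℝ => u₀ x * ∫ p : ℝ, φ p * Complex.exp (-Complex.I * x * p)) ∧
    MeasureTheory.Integrable (fun p : ℝ => Fu₀ p * φ p) ∧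
    ∫ x : ℝ, u₀ x * (∫ p : ℝ, φ p * Complex.exp (-Complex.I * x * p)) = ∫ p : ℝ, Fu₀ p * φ p

/-- The initial datum `u₀` has Fourier transform `Fu₀`, which vanishes outside `[p₁, p₂]`, vanishes
at `p₂`, and equals `(p - p₁)^(μ-1) v(p)` on `(p₁, p₂]`, where `v` is `C¹` on `[p₁, p₂]` and
`v(p₁) ≠ 0`. -/
structure SingularFrequencyCondition (p₁ p₂ μ : ℝ) (u₀ Fu₀ v : ℝ → ℂ) : Prop where
  fourier : IsFourierTransformOf Fu₀ u₀
  support : ∀ p, p ∉ Set.Icc p₁ p₂ → Fu₀ p = 0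
  regular : ContDiffOn ℝ 1 v (Set.Icc p₁ p₂)
  amplitude : ∀ p ∈ Set.Ioc p₁ p₂, Fu₀ p = (((p - p₁) ^ (μ - 1) : ℝ) : ℂ) * v p
  left_ne_zero : v p₁ ≠ 0
  right_eq_zero : Fu₀ p₂ = 0

/-- `u` is the solution of the Cauchy problem `i ∂ₜu + ∂ₓ²u = 0`, `u(0, ·) = u₀`, for `t ≥ 0`: a
continuous function, bounded on every strip `[0, T] × ℝ`, which satisfies the equation in the sense
of tempered distributions in `x`, i.e. `d/dt ⟨u(t), φ⟩ = i ⟨u(t), φ''⟩` for all Schwartz `φ`. -/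
structure IsFreeSchrodingerSolution (u₀ : ℝ → ℂ) (u : ℝ → ℝ → ℂ) : Prop where
  continuous : ContinuousOn (fun z : ℝ × ℝ => u z.1 z.2) (Set.Ici 0 ×ˢ Set.univ)
  bounded : ∀ T : ℝ, ∃ C : ℝ, ∀ t ∈ Set.Icc 0 T, ∀ x : ℝ, ‖u t x‖ ≤ C
  initial : ∀ x : ℝ, u 0 x = u₀ x
  equation : ∀ φ : SchwartzMap ℝ ℂ, ∀ t : ℝ, 0 < t →
    HasDerivAt (fun s : ℝ => ∫ x : ℝ, u s x * φ x)
      (Complex.I * ∫ x : ℝ, u t x * iteratedDeriv 2 φ x) t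

/-- The space-time curve `x / (2t) - p₁ = t^(-ε)`, `t > 0`. -/
def criticalCurve (ε p₁ : ℝ) : Set (ℝ × ℝ) :=
  {z | 0 < z.1 ∧ z.2 / (2 * z.1) - p₁ = z.1 ^ (-ε)}

/-- The time threshold `T_p = (2 (p - p₁))^(-1/ε)`. -/
def timeThreshold (ε p₁ p : ℝ) : ℝ := (2 * (p - p₁)) ^ (-(1 / ε))

/-- The coefficient
`H(t) = (1 / (2 √π)) e^{-iπ/4} e^{i t (p₁ + t^(-ε))²} v(p₁ + t^(-ε))`, `v` being extended by zero
outside `[p₁, p₂]`. -/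
def coeffH (p₁ p₂ ε : ℝ) (v : ℝ → ℂ) (t : ℝ) : ℂ :=
  (1 / (2 * √Real.pi) : ℝ) * Complex.exp (-Complex.I * (Real.pi / 4 : ℝ)) *
    Complex.exp (Complex.I * (t * (p₁ + t ^ (-ε)) ^ 2 : ℝ)) *
    (Set.Icc p₁ p₂).indicator v (p₁ + t ^ (-ε))

/-- The coefficient
`K_μ(t) = (Γ(μ) / (2^(μ+1) π)) e^{iπμ/2} e^{i t (p₁² + 2 p₁ t^(-ε))} v(p₁)`; on the curve the last
phase is `-t p₁² + x p₁`. -/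
def coeffK (μ p₁ ε : ℝ) (v : ℝ → ℂ) (t : ℝ) : ℂ :=
  (Real.Gamma μ / (2 ^ (μ + 1) * Real.pi) : ℝ) *
    Complex.exp (Complex.I * (Real.pi * μ / 2 : ℝ)) *
    Complex.exp (Complex.I * (t * (p₁ ^ 2 + 2 * p₁ * t ^ (-ε)) : ℝ)) * v p₁

/-- The supremum norm of `v` on `[p₁, p₂]`. -/
def supNormOn (p₁ p₂ : ℝ) (v : ℝ → ℂ) : ℝ := sSup ((fun p => ‖v p‖) '' Set.Icc p₁ p₂)

/-- The bound `R_H = ‖v‖_∞ / (2 √π)` of the coefficient `H`. -/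
def boundH (p₁ p₂ : ℝ) (v : ℝ → ℂ) : ℝ := 1 / (2 * √Real.pi) * supNormOn p₁ p₂ v

/-- The bound `R_K = Γ(μ) ‖v‖_∞ / (2^(μ+1) π)` of the coefficient `K_μ`. -/
def boundK (μ p₁ p₂ : ℝ) (v : ℝ → ℂ) : ℝ :=
  Real.Gamma μ / (2 ^ (μ + 1) * Real.pi) * supNormOn p₁ p₂ v

end

noncomputable section

open MeasureTheory Set Filter Topology
open scoped FourierTransform

/-! With `s = t ^ (-ε)`, completing the square on the curve turns Fourier inversion into `2π u =
e^{it(p₁+s)²} ∫₀^L q^(μ-1) w(q) e^{-it(q-s)²} dq`, where `L = p₂ - p₁` and `w(q) = v(p₁+q)`. The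
stationary point `s` drifts towards the singularity `0`, but since `ε < 1/2` it stays far outside
the scale `σ = t^(-1/2)`, so the two contributions separate.

The integral is cut at `σ` and `s`. On `[0, σ]` the Gaussian phase `e^{-itq²}` joins the amplitude,
and integration by parts against a primitive of `q^(μ-1) e^{2itsq}` yields the `K` term at `0`. On
`[σ, s]` and `[s, L]` the amplitude is differentiable, and integration by parts against a Fresnel
tail yields half of the `H` term on each side of `s`; nothing appears at `L` because `w(L) = 0`. The
errors are `t^(-3/4) s^(μ-3/2)` and `σ^(μ-1)/(ts)`, which are the exponents `α` and `β`
(`IsC1Amplitude.norm_integral_sub_le`). Both primitives come from one incomplete Gamma function,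
`oscGamma`, written on a ray where it converges absolutely.

The solution is only assumed weak, so the inversion formula must be proved
(`IsFreeSchrodingerSolution.eq_integral`). Against a test function with compactly supported
frequency, the defect from the frequency-side evolution obeys a hierarchy driven by multiplication
by `p²`, a bounded operation there; iterating forces the defect to vanish.

For the lower bound, the leading coefficient has modulus bounded away from zero. At `μ = 1/2` the
terms `K` and `H` have the same rate, but `|K| / |H|` tends to `1/√2`, so they cannot cancel. -/

/-! ### Incomplete Gamma function of an imaginary exponential. -/

theorem norm_ofReal_add_I_mul_rpow_le_left {c a τ : ℝ} (hc : c ≤ 0) (ha : 0 < a) :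
    ‖((a : ℂ) + Complex.I * τ) ^ ((c : ℝ) : ℂ)‖ ≤ a ^ c := by
  rw [Complex.norm_cpow_real]
  refine Real.rpow_le_rpow_of_nonpos ha ?_ hc
  have := Complex.abs_re_le_norm ((a : ℂ) + Complex.I * τ)
  simp only [Complex.add_re, Complex.ofReal_re, Complex.mul_re, Complex.I_re, Complex.I_im,
    Complex.ofReal_im, zero_mul, mul_zero, sub_zero, add_zero] at this
  exact (le_abs_self a).trans this

theorem norm_ofReal_add_I_mul_rpow_le_right {c a τ : ℝ} (hc : c ≤ 0) (hτ : 0 < τ) :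
    ‖((a : ℂ) + Complex.I * τ) ^ ((c : ℝ) : ℂ)‖ ≤ τ ^ c := by
  rw [Complex.norm_cpow_real]
  refine Real.rpow_le_rpow_of_nonpos hτ ?_ hc
  have := Complex.abs_im_le_norm ((a : ℂ) + Complex.I * τ)
  simp only [Complex.add_im, Complex.ofReal_re, Complex.mul_im, Complex.I_re, Complex.I_im,
    Complex.ofReal_im, zero_mul, one_mul, zero_add] at this
  exact (le_abs_self τ).trans this

theorem ofReal_add_I_mul_mem_slitPlane {a τ : ℝ} (h : 0 < a ∨ 0 < τ) :
    (a : ℂ) + Complex.I * τ ∈ Complex.slitPlane := by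
  rw [Complex.mem_slitPlane_iff]
  rcases h with h | h
  · left; simpa using h
  · right; simpa using h.ne'

/-- The upper incomplete Gamma function `∫_a^∞ y^(μ-1) e^{iy} dy` of an imaginary exponential, as an
absolutely convergent integral over the ray `a + i [0, ∞)`. -/
def oscGamma (μ a : ℝ) : ℂ :=
  Complex.I * Complex.exp (Complex.I * a) *
    ∫ τ in Ioi (0 : ℝ), ((a : ℂ) + Complex.I * τ) ^ ((μ - 1 : ℝ) : ℂ) * (Real.exp (-τ) : ℂ)

theorem continuousOn_ray_cpow (c a : ℝ) :
    ContinuousOn (fun τ : ℝ => ((a : ℂ) + Complex.I * τ) ^ ((c : ℝ) : ℂ) * (Real.exp (-τ) : ℂ))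
      (Ioi 0) := by
  refine ContinuousOn.mul (ContinuousOn.cpow_const (by fun_prop) fun τ hτ => ?_) (by fun_prop)
  exact ofReal_add_I_mul_mem_slitPlane (Or.inr hτ)

theorem aestronglyMeasurable_ray_cpow (c a : ℝ) :
    AEStronglyMeasurable
      (fun τ : ℝ => ((a : ℂ) + Complex.I * τ) ^ ((c : ℝ) : ℂ) * (Real.exp (-τ) : ℂ))
      (volume.restrict (Ioi 0)) :=
  (continuousOn_ray_cpow c a).aestronglyMeasurable measurableSet_Ioi

theorem integrableOn_rpow_mul_exp_neg {μ : ℝ} (hμ : 0 < μ) :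
    IntegrableOn (fun τ : ℝ => τ ^ (μ - 1) * Real.exp (-τ)) (Ioi 0) := by
  simpa only [mul_comm] using Real.GammaIntegral_convergent hμ

theorem integrableOn_const_mul_exp_neg (C : ℝ) :
    IntegrableOn (fun τ : ℝ => C * Real.exp (-τ)) (Ioi 0) :=
  (integrableOn_exp_neg_Ioi 0).const_mul C

theorem norm_ray_cpow_le_right {c a τ : ℝ} (hc : c ≤ 0) (hτ : 0 < τ) :
    ‖((a : ℂ) + Complex.I * τ) ^ ((c : ℝ) : ℂ) * (Real.exp (-τ) : ℂ)‖ ≤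
      τ ^ c * Real.exp (-τ) := by
  rw [norm_mul, Complex.norm_real, Real.norm_of_nonneg (Real.exp_pos _).le]
  exact mul_le_mul_of_nonneg_right (norm_ofReal_add_I_mul_rpow_le_right hc hτ) (Real.exp_pos _).le

theorem norm_ray_cpow_le_left {c a τ : ℝ} (hc : c ≤ 0) (ha : 0 < a) :
    ‖((a : ℂ) + Complex.I * τ) ^ ((c : ℝ) : ℂ) * (Real.exp (-τ) : ℂ)‖ ≤
      a ^ c * Real.exp (-τ) := by
  rw [norm_mul, Complex.norm_real, Real.norm_of_nonneg (Real.exp_pos _).le]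
  exact mul_le_mul_of_nonneg_right (norm_ofReal_add_I_mul_rpow_le_left hc ha) (Real.exp_pos _).le

theorem norm_oscGamma_eq (μ a : ℝ) :
    ‖oscGamma μ a‖ =
      ‖∫ τ in Ioi (0 : ℝ), ((a : ℂ) + Complex.I * τ) ^ ((μ - 1 : ℝ) : ℂ) *
        (Real.exp (-τ) : ℂ)‖ := by
  rw [oscGamma, norm_mul, norm_mul, Complex.norm_I, mul_comm Complex.I (a : ℂ),
    Complex.norm_exp_ofReal_mul_I, one_mul, one_mul]

theorem norm_oscGamma_le_rpow {μ a : ℝ} (h1 : μ ≤ 1) (ha : 0 < a) :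
    ‖oscGamma μ a‖ ≤ a ^ (μ - 1) := by
  rw [norm_oscGamma_eq]
  refine (norm_integral_le_of_norm_le (integrableOn_const_mul_exp_neg (a ^ (μ - 1)))
    (ae_of_all _ fun τ => norm_ray_cpow_le_left (by linarith) ha)).trans_eq ?_
  rw [integral_const_mul, integral_exp_neg_Ioi_zero, mul_one]

theorem norm_oscGamma_le_Gamma {μ : ℝ} (h0 : 0 < μ) (h1 : μ ≤ 1) (a : ℝ) :
    ‖oscGamma μ a‖ ≤ Real.Gamma μ := by
  rw [norm_oscGamma_eq, Real.Gamma_eq_integral h0]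
  simp only [mul_comm (Real.exp _) (_ ^ (μ - 1))]
  exact norm_integral_le_of_norm_le (integrableOn_rpow_mul_exp_neg h0)
    ((ae_restrict_iff' measurableSet_Ioi).2 (ae_of_all _ fun _ hτ =>
      norm_ray_cpow_le_right (by linarith) hτ))

/-- At `a = 0` the power splits as `(iτ)^(μ-1) = i^(μ-1) τ^(μ-1)`, leaving the Euler integral, and
`i · i^(μ-1) = e^{iπμ/2}`. -/
theorem oscGamma_zero {μ : ℝ} (h0 : 0 < μ) :
    oscGamma μ 0 = Real.Gamma μ * Complex.exp (Complex.I * (Real.pi * μ / 2 : ℝ)) := by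
  have key : ∀ τ ∈ Ioi (0 : ℝ),
      (((0 : ℝ) : ℂ) + Complex.I * τ) ^ ((μ - 1 : ℝ) : ℂ) * (Real.exp (-τ) : ℂ) =
        Complex.I ^ ((μ - 1 : ℝ) : ℂ) * ((Real.exp (-τ) * τ ^ (μ - 1) : ℝ) : ℂ) := by
    intro τ hτ
    have hτ' : (0 : ℝ) < τ := hτ
    have hτc : (τ : ℂ) ≠ 0 := Complex.ofReal_ne_zero.2 hτ'.ne'
    rw [Complex.ofReal_zero, zero_add,
      Complex.cpow_def_of_ne_zero (mul_ne_zero Complex.I_ne_zero hτc),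
      Complex.log_mul_ofReal τ hτ' _ Complex.I_ne_zero, add_mul, Complex.exp_add,
      Complex.cpow_def_of_ne_zero Complex.I_ne_zero, Real.rpow_def_of_pos hτ']
    push_cast
    ring
  rw [oscGamma, setIntegral_congr_fun measurableSet_Ioi key, integral_const_mul,
    integral_complex_ofReal, ← Real.Gamma_eq_integral h0]
  rw [Complex.cpow_def_of_ne_zero Complex.I_ne_zero, Complex.log_I]
  have h1 : Complex.exp (Complex.I * (Real.pi * μ / 2 : ℝ)) =
      Complex.I * Complex.exp (Real.pi / 2 * Complex.I * ((μ - 1 : ℝ) : ℂ)) := by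
    nth_rewrite 2 [← Complex.exp_pi_div_two_mul_I]
    rw [← Complex.exp_add]
    congr 1
    push_cast
    ring
  rw [h1, Complex.ofReal_zero, mul_zero, Complex.exp_zero]
  ring

/-- The majorant `τ^(μ-1) e^{-τ}` does not depend on `a`, so continuity reaches the endpoint `0`,
where the boundary terms of the later integrations by parts are read off. -/
theorem continuousOn_oscGamma {μ : ℝ} (h0 : 0 < μ) (h1 : μ ≤ 1) :
    ContinuousOn (oscGamma μ) (Ici 0) := by
  refine ContinuousOn.mul (by fun_prop) ?_
  refine continuousOn_of_dominated (bound := fun τ : ℝ => τ ^ (μ - 1) * Real.exp (-τ))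
    (fun a _ => aestronglyMeasurable_ray_cpow _ _)
    (fun a _ => (ae_restrict_iff' measurableSet_Ioi).2 (ae_of_all _ fun _ hτ =>
      norm_ray_cpow_le_right (by linarith) hτ))
    (integrableOn_rpow_mul_exp_neg h0) ?_
  refine (ae_restrict_iff' measurableSet_Ioi).2 (ae_of_all _ fun τ hτ => ?_)
  refine ContinuousOn.mul (ContinuousOn.cpow_const (by fun_prop) fun a _ => ?_) (by fun_prop)
  exact ofReal_add_I_mul_mem_slitPlane (Or.inr hτ)

theorem hasDerivAt_ofReal_add_cpow (c : ℝ) {a τ : ℝ} (ha : 0 < a) :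
    HasDerivAt (fun x : ℝ => ((x : ℂ) + Complex.I * τ) ^ ((c : ℝ) : ℂ))
      (c * ((a : ℂ) + Complex.I * τ) ^ ((c - 1 : ℝ) : ℂ)) a := by
  have h := (((hasDerivAt_id (a : ℂ)).add_const (Complex.I * τ)).cpow_const
    (c := (c : ℂ)) (ofReal_add_I_mul_mem_slitPlane (τ := τ) (Or.inl ha))).comp_ofReal
  simpa using h

theorem hasDerivAt_ray_cpow (c : ℝ) {a τ : ℝ} (ha : 0 < a) :
    HasDerivAt (fun x : ℝ => ((a : ℂ) + Complex.I * x) ^ ((c : ℝ) : ℂ))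
      (Complex.I * (c * ((a : ℂ) + Complex.I * τ) ^ ((c - 1 : ℝ) : ℂ))) τ := by
  have h := ((((hasDerivAt_id (τ : ℂ)).const_mul Complex.I).const_add (a : ℂ)).cpow_const
    (c := (c : ℂ)) (ofReal_add_I_mul_mem_slitPlane (τ := τ) (Or.inl ha))).comp_ofReal
  refine h.congr_deriv ?_
  simp
  ring

theorem integrableOn_ray_cpow_of_pos {c a : ℝ} (hc : c ≤ 0) (ha : 0 < a) :
    IntegrableOn
      (fun τ : ℝ => ((a : ℂ) + Complex.I * τ) ^ ((c : ℝ) : ℂ) * (Real.exp (-τ) : ℂ))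
      (Ioi 0) :=
  (integrableOn_const_mul_exp_neg (a ^ c)).mono' (aestronglyMeasurable_ray_cpow _ _)
    (ae_of_all _ fun _ => norm_ray_cpow_le_left hc ha)

theorem hasDerivAt_integral_ray_cpow {c a : ℝ} (hc : c ≤ 0) (ha : 0 < a) :
    HasDerivAt (fun x : ℝ => ∫ τ in Ioi (0 : ℝ),
        ((x : ℂ) + Complex.I * τ) ^ ((c : ℝ) : ℂ) * (Real.exp (-τ) : ℂ))
      (∫ τ in Ioi (0 : ℝ), (c * ((a : ℂ) + Complex.I * τ) ^ ((c - 1 : ℝ) : ℂ)) *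
        (Real.exp (-τ) : ℂ)) a := by
  -- Staying above `a / 2` keeps the power uniformly bounded.
  have hmem : ∀ x ∈ Metric.ball a (a / 2), a / 2 < x := fun x hx => by
    rw [Metric.mem_ball, Real.dist_eq, abs_lt] at hx; linarith [hx.1]
  refine (hasDerivAt_integral_of_dominated_loc_of_deriv_le
    (bound := fun τ : ℝ => |c| * ((a / 2) ^ (c - 1) * Real.exp (-τ)))
    (F' := fun x τ => (c * ((x : ℂ) + Complex.I * τ) ^ ((c - 1 : ℝ) : ℂ)) *
        (Real.exp (-τ) : ℂ))
    (Metric.ball_mem_nhds a (half_pos ha)) ?_ ?_ ?_ ?_ ?_ ?_).2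
  · exact Eventually.of_forall fun x => aestronglyMeasurable_ray_cpow _ _
  · exact integrableOn_ray_cpow_of_pos hc ha
  · simp only [mul_assoc]
    exact (aestronglyMeasurable_ray_cpow _ _).const_mul _
  · refine ae_of_all _ fun τ x hx => ?_
    have hx' := hmem x hx
    rw [mul_assoc, norm_mul, Complex.norm_real, Real.norm_eq_abs]
    refine mul_le_mul_of_nonneg_left ((norm_ray_cpow_le_left (by linarith)
      (by linarith)).trans ?_) (abs_nonneg _)
    exact mul_le_mul_of_nonneg_right
      (Real.rpow_le_rpow_of_nonpos (by linarith) hx'.le (by linarith)) (Real.exp_pos _).le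
  · exact (integrableOn_const_mul_exp_neg _).const_mul _
  · refine ae_of_all _ fun τ x hx => ?_
    exact (hasDerivAt_ofReal_add_cpow c (by linarith [hmem x hx])).mul_const _

/-- The fundamental theorem of calculus for `(a + iτ)^c e^{-τ}` along the ray, whose value at `τ =
0` is `a^c`. This makes the integrals cancel in the derivative of `oscGamma`. -/
theorem integral_ray_cpow_sub_one {c a : ℝ} (hc : c ≤ 0) (ha : 0 < a) :
    Complex.I * (∫ τ in Ioi (0 : ℝ), (c * ((a : ℂ) + Complex.I * τ) ^ ((c - 1 : ℝ) : ℂ)) *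
        (Real.exp (-τ) : ℂ)) =
      (∫ τ in Ioi (0 : ℝ), ((a : ℂ) + Complex.I * τ) ^ ((c : ℝ) : ℂ) *
        (Real.exp (-τ) : ℂ)) - ((a ^ c : ℝ) : ℂ) := by
  have hd : ∀ τ ∈ Ici (0 : ℝ), HasDerivAt
      (fun τ : ℝ => ((a : ℂ) + Complex.I * τ) ^ ((c : ℝ) : ℂ) * (Real.exp (-τ) : ℂ))
      (Complex.I * ((c * ((a : ℂ) + Complex.I * τ) ^ ((c - 1 : ℝ) : ℂ)) * (Real.exp (-τ) : ℂ)) -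
        ((a : ℂ) + Complex.I * τ) ^ ((c : ℝ) : ℂ) * (Real.exp (-τ) : ℂ)) τ := by
    intro τ _
    have h1 : HasDerivAt (fun τ : ℝ => (Real.exp (-τ) : ℂ)) (-(Real.exp (-τ)) : ℂ) τ := by
      have := ((hasDerivAt_neg τ).exp).ofReal_comp
      simpa using this
    exact ((hasDerivAt_ray_cpow c ha).mul h1).congr_deriv (by ring)
  have hi1 : IntegrableOn (fun τ : ℝ => Complex.I *
      ((c * ((a : ℂ) + Complex.I * τ) ^ ((c - 1 : ℝ) : ℂ)) * (Real.exp (-τ) : ℂ))) (Ioi 0) := by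
    simp only [mul_assoc]
    exact ((integrableOn_ray_cpow_of_pos (by linarith) ha).const_mul _).const_mul _
  have hi2 := integrableOn_ray_cpow_of_pos hc ha
  have hlim : Tendsto
      (fun τ : ℝ => ((a : ℂ) + Complex.I * τ) ^ ((c : ℝ) : ℂ) * (Real.exp (-τ) : ℂ))
      atTop (𝓝 0) := by
    refine squeeze_zero_norm (fun τ => norm_ray_cpow_le_left hc ha) ?_
    simpa using (Real.tendsto_exp_neg_atTop_nhds_zero).const_mul (a ^ c)
  have h := integral_Ioi_of_hasDerivAt_of_tendsto' hd (hi1.sub hi2) hlim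
  rw [integral_sub hi1 hi2, integral_const_mul] at h
  rw [sub_eq_iff_eq_add] at h
  rw [h]
  simp only [Complex.ofReal_zero, mul_zero, add_zero, neg_zero, Real.exp_zero, Complex.ofReal_one,
    mul_one, Complex.ofReal_cpow ha.le]
  ring

theorem hasDerivAt_oscGamma {μ a : ℝ} (h1 : μ ≤ 1) (ha : 0 < a) :
    HasDerivAt (oscGamma μ) (-(((a ^ (μ - 1) : ℝ) : ℂ) * Complex.exp (Complex.I * a))) a := by
  have hc : μ - 1 ≤ 0 := by linarith
  have he : HasDerivAt (fun x : ℝ => Complex.I * Complex.exp (Complex.I * x))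
      (Complex.I * (Complex.exp (Complex.I * a) * Complex.I)) a := by
    have := ((Complex.ofRealCLM.hasDerivAt (x := a)).const_mul Complex.I).cexp.const_mul Complex.I
    simpa using this
  have h := he.mul (hasDerivAt_integral_ray_cpow hc ha)
  refine h.congr_deriv ?_
  have h2 := integral_ray_cpow_sub_one hc ha
  linear_combination (norm := skip) (Complex.exp (Complex.I * a)) * h2 
  ring_nf
  simp only [Complex.I_sq]
  ring

/-! ### Primitives for the singular phase and for the Fresnel phase. -/

/-- The primitive of `q ↦ q^(μ-1) e^{ikq}` on `(0, ∞)` that vanishes at infinity. -/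
def powExpPrimitive (μ k q : ℝ) : ℂ := -(((k ^ (-μ) : ℝ) : ℂ) * oscGamma μ (k * q))

theorem hasDerivAt_powExpPrimitive {μ k q : ℝ} (h1 : μ ≤ 1) (hk : 0 < k) (hq : 0 < q) :
    HasDerivAt (powExpPrimitive μ k)
      (((q ^ (μ - 1) : ℝ) : ℂ) * Complex.exp (Complex.I * (k * q : ℝ))) q := by
  have hd : HasDerivAt (fun x : ℝ => k * x) k q := by
    simpa using (hasDerivAt_id q).const_mul k
  have h := (((hasDerivAt_oscGamma h1 (mul_pos hk hq)).scomp q hd).const_mul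
    ((k ^ (-μ) : ℝ) : ℂ)).neg
  refine h.congr_deriv ?_
  have h3 : k ^ (-μ) * k * (k * q) ^ (μ - 1) = q ^ (μ - 1) := by
    rw [Real.mul_rpow hk.le hq.le, ← mul_assoc]
    nth_rewrite 2 [← Real.rpow_one k]
    rw [← Real.rpow_add hk, ← Real.rpow_add hk]
    norm_num
  rw [← h3, Complex.real_smul]
  push_cast
  ring

theorem continuousOn_powExpPrimitive {μ k : ℝ} (h0 : 0 < μ) (h1 : μ ≤ 1) (hk : 0 < k) :
    ContinuousOn (powExpPrimitive μ k) (Ici 0) :=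
  (continuousOn_const.mul ((continuousOn_oscGamma h0 h1).comp (by fun_prop)
    fun _ hq => mul_nonneg hk.le hq)).neg

theorem norm_powExpPrimitive_le {μ k q : ℝ} (h1 : μ ≤ 1) (hk : 0 < k) (hq : 0 < q) :
    ‖powExpPrimitive μ k q‖ ≤ q ^ (μ - 1) / k := by
  rw [powExpPrimitive, norm_neg, norm_mul, Complex.norm_real,
    Real.norm_of_nonneg (Real.rpow_nonneg hk.le _)]
  refine (mul_le_mul_of_nonneg_left (norm_oscGamma_le_rpow h1 (mul_pos hk hq))
    (Real.rpow_nonneg hk.le _)).trans_eq ?_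
  rw [Real.mul_rpow hk.le hq.le, ← mul_assoc, ← Real.rpow_add hk, neg_add_eq_sub,
    sub_sub_cancel_left, Real.rpow_neg_one]
  ring

/-- The Fresnel tail `∫_q^∞ e^{-itr²} dr`, `q ≥ 0`. -/
def fresnelTail (t q : ℝ) : ℂ :=
  ((1 / (2 * √t) : ℝ) : ℂ) * (starRingEnd ℂ) (oscGamma (1 / 2) (t * q ^ 2))

/-- The substitution `y = t r²` identifies the tail with the conjugate of `oscGamma (1 / 2)`; the
factor `1 / (2√t)` cancels the Jacobian, which is `h4`. -/
theorem hasDerivAt_fresnelTail {t q : ℝ} (ht : 0 < t) (hq : 0 < q) :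
    HasDerivAt (fresnelTail t) (-Complex.exp (-Complex.I * (t * q ^ 2 : ℝ))) q := by
  have hd : HasDerivAt (fun x : ℝ => t * x ^ 2) (t * (2 * q)) q := by
    simpa using (hasDerivAt_pow 2 q).const_mul t
  have h := ((hasDerivAt_oscGamma (μ := 1 / 2) (by norm_num)
    (mul_pos ht (pow_pos hq 2))).scomp q hd).star.const_mul ((1 / (2 * √t) : ℝ) : ℂ)
  refine h.congr_deriv ?_
  have h3 : (t * q ^ 2) ^ ((1 : ℝ) / 2 - 1) = (√t * q)⁻¹ := by
    rw [show (1 : ℝ) / 2 - 1 = -(1 / 2) by norm_num, Real.rpow_neg (by positivity),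
      ← Real.sqrt_eq_rpow, Real.sqrt_mul ht.le, Real.sqrt_sq hq.le]
  have h4 : 1 / (2 * √t) * (t * (2 * q) * (√t * q)⁻¹) = 1 := by
    have := Real.mul_self_sqrt ht.le
    have h5 : √t ≠ 0 := (Real.sqrt_pos.2 ht).ne'
    field_simp
    nlinarith
  have h4' := congrArg (fun x : ℝ => (x : ℂ)) h4
  rw [h3, Complex.real_smul]
  simp only [Complex.star_def, map_mul, map_neg, Complex.conj_ofReal, ← Complex.exp_conj,
    Complex.conj_I]
  push_cast at h4' ⊢
  linear_combination (-Complex.exp (-Complex.I * (t * q ^ 2))) * h4'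

theorem continuousOn_fresnelTail {t : ℝ} (ht : 0 < t) : ContinuousOn (fresnelTail t) (Ici 0) :=
  continuousOn_const.mul (Complex.continuous_conj.comp_continuousOn
    ((continuousOn_oscGamma (by norm_num) (by norm_num)).comp (by fun_prop)
      fun q _ => mul_nonneg ht.le (sq_nonneg q)))

theorem norm_fresnelTail (t q : ℝ) :
    ‖fresnelTail t q‖ = 1 / (2 * √t) * ‖oscGamma (1 / 2) (t * q ^ 2)‖ := by
  rw [fresnelTail, norm_mul, Complex.norm_real, RCLike.norm_conj,
    Real.norm_of_nonneg (by positivity)]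

theorem norm_fresnelTail_le_inv {t q : ℝ} (ht : 0 < t) (hq : 0 < q) :
    ‖fresnelTail t q‖ ≤ 1 / (2 * t * q) := by
  have h := norm_oscGamma_le_rpow (μ := 1 / 2) (by norm_num) (mul_pos ht (pow_pos hq 2))
  have h3 : (t * q ^ 2) ^ ((1 : ℝ) / 2 - 1) = (√t * q)⁻¹ := by
    rw [show (1 : ℝ) / 2 - 1 = -(1 / 2) by norm_num, Real.rpow_neg (by positivity),
      ← Real.sqrt_eq_rpow, Real.sqrt_mul ht.le, Real.sqrt_sq hq.le]
  rw [norm_fresnelTail]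
  refine (mul_le_mul_of_nonneg_left h (by positivity)).trans_eq ?_
  have h5 : √t ≠ 0 := (Real.sqrt_pos.2 ht).ne'
  rw [h3]
  nth_rewrite 3 [← Real.mul_self_sqrt ht.le]
  field_simp

/-- Interpolates between the decay `a^(-1/2)` and the bound `Γ(1/2) = √π ≤ 2` at `a = tq²`. The
power `q^(-1/2)` is integrable at the stationary point, unlike the `1/q` of
`norm_fresnelTail_le_inv`. -/
theorem norm_fresnelTail_le_rpow {t q : ℝ} (ht : 0 < t) (hq : 0 < q) :
    ‖fresnelTail t q‖ ≤ t ^ (-(3 / 4) : ℝ) * q ^ (-(1 / 2) : ℝ) := by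
  have ha : 0 < t * q ^ 2 := by positivity
  have h : ‖oscGamma (1 / 2) (t * q ^ 2)‖ ≤ 2 * (t * q ^ 2) ^ (-(1 / 4) : ℝ) := by
    rcases le_total 1 (t * q ^ 2) with h | h
    · refine (norm_oscGamma_le_rpow (μ := 1 / 2) (by norm_num) ha).trans ?_
      refine (Real.rpow_le_rpow_of_exponent_le h (by norm_num : (1 : ℝ) / 2 - 1 ≤ -(1 / 4))).trans ?_
      linarith [Real.rpow_pos_of_pos ha (-(1 / 4))]
    · refine (norm_oscGamma_le_Gamma (by norm_num) (by norm_num) _).trans ?_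
      rw [Real.Gamma_one_half_eq]
      have h6 : √Real.pi ≤ 2 := by
        rw [Real.sqrt_le_left (by norm_num)]; linarith [Real.pi_le_four]
      have h7 := Real.one_le_rpow_of_pos_of_le_one_of_nonpos ha h (by norm_num : -(1 / 4 : ℝ) ≤ 0)
      linarith
  rw [norm_fresnelTail]
  refine (mul_le_mul_of_nonneg_left h (by positivity)).trans_eq ?_
  rw [Real.mul_rpow ht.le (by positivity), ← Real.rpow_natCast q 2, ← Real.rpow_mul hq.le,
    Real.sqrt_eq_rpow, one_div, mul_inv, ← Real.rpow_neg ht.le]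
  have h8 : t ^ (-(3 / 4) : ℝ) = t ^ (-(1 / 2) : ℝ) * t ^ (-(1 / 4) : ℝ) := by
    rw [← Real.rpow_add ht]; norm_num
  rw [h8]
  norm_num
  ring

theorem fresnelTail_zero (t : ℝ) :
    2 * fresnelTail t 0 =
      ((√Real.pi / √t : ℝ) : ℂ) * Complex.exp (-Complex.I * (Real.pi / 4 : ℝ)) := by
  rw [fresnelTail, zero_pow two_ne_zero, mul_zero, oscGamma_zero (by norm_num),
    Real.Gamma_one_half_eq, map_mul, Complex.conj_ofReal, ← Complex.exp_conj, map_mul,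
    Complex.conj_I, Complex.conj_ofReal,
    show Real.pi * (1 / 2) / 2 = Real.pi / 4 by ring]
  push_cast
  field_simp

/-! ### The oscillatory integral with a singular amplitude. -/

/-- `w` is `C¹` on `[0, L]` with derivative `w'`, both are bounded by `M`, and `w L = 0`. -/
structure IsC1Amplitude (L M : ℝ) (w w' : ℝ → ℂ) : Prop where
  continuousOn : ContinuousOn w (Icc 0 L)
  hasDerivAt : ∀ q ∈ Ioo 0 L, HasDerivAt w (w' q) q
  continuousOn_deriv : ContinuousOn w' (Icc 0 L)
  norm_le : ∀ q ∈ Icc 0 L, ‖w q‖ ≤ M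
  norm_deriv_le : ∀ q ∈ Icc 0 L, ‖w' q‖ ≤ M
  right_eq_zero : w L = 0

/-- The amplitude `q^(μ-1) w(q)` with an integrable singularity at the origin. -/
def singularAmplitude (μ : ℝ) (w : ℝ → ℂ) (q : ℝ) : ℂ := ((q ^ (μ - 1) : ℝ) : ℂ) * w q

/-- The derivative of `singularAmplitude μ w` if `w'` is the derivative of `w`. -/
def singularAmplitudeDeriv (μ : ℝ) (w w' : ℝ → ℂ) (q : ℝ) : ℂ :=
  (((μ - 1) * q ^ (μ - 2) : ℝ) : ℂ) * w q + ((q ^ (μ - 1) : ℝ) : ℂ) * w' q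

theorem intervalIntegrable_ofReal_rpow {r : ℝ} (hr : -1 < r) (a b : ℝ) :
    IntervalIntegrable (fun q : ℝ => ((q ^ r : ℝ) : ℂ)) volume a b :=
  have h := intervalIntegral.intervalIntegrable_rpow' (a := a) (b := b) hr
  ⟨h.1.ofReal, h.2.ofReal⟩

namespace IsC1Amplitude

variable {L M : ℝ} {w w' : ℝ → ℂ}

theorem nonneg (h : IsC1Amplitude L M w w') (hL : 0 ≤ L) : 0 ≤ M :=
  (norm_nonneg _).trans (h.norm_le 0 ⟨le_rfl, hL⟩)

theorem hasDerivAt_singularAmplitude (h : IsC1Amplitude L M w w') (μ : ℝ) {q : ℝ}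
    (hq : q ∈ Ioo 0 L) :
    HasDerivAt (singularAmplitude μ w) (singularAmplitudeDeriv μ w w' q) q := by
  have h1 := (Real.hasDerivAt_rpow_const (p := μ - 1) (Or.inl hq.1.ne')).ofReal_comp
  have h2 := h1.mul (h.hasDerivAt q hq)
  rwa [show μ - 1 - 1 = μ - 2 by ring] at h2

theorem continuousOn_singularAmplitude (h : IsC1Amplitude L M w w') (μ : ℝ) :
    ContinuousOn (singularAmplitude μ w) (Ioc 0 L) :=
  (Complex.continuous_ofReal.comp_continuousOn
    (continuousOn_id.rpow_const fun _ hq => Or.inl hq.1.ne')).mul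
      (h.continuousOn.mono Ioc_subset_Icc_self)

theorem continuousOn_singularAmplitudeDeriv (h : IsC1Amplitude L M w w') (μ : ℝ) :
    ContinuousOn (singularAmplitudeDeriv μ w w') (Ioc 0 L) :=
  ((Complex.continuous_ofReal.comp_continuousOn (continuousOn_const.mul
    (continuousOn_id.rpow_const fun _ hq => Or.inl hq.1.ne'))).mul
      (h.continuousOn.mono Ioc_subset_Icc_self)).add
  ((Complex.continuous_ofReal.comp_continuousOn
    (continuousOn_id.rpow_const fun _ hq => Or.inl hq.1.ne')).mul
      (h.continuousOn_deriv.mono Ioc_subset_Icc_self))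

theorem norm_singularAmplitude_le (h : IsC1Amplitude L M w w') (μ : ℝ) {q : ℝ}
    (hq : q ∈ Ioc 0 L) : ‖singularAmplitude μ w q‖ ≤ M * q ^ (μ - 1) := by
  rw [singularAmplitude, norm_mul, Complex.norm_real,
    Real.norm_of_nonneg (Real.rpow_nonneg hq.1.le _), mul_comm]
  exact mul_le_mul_of_nonneg_right (h.norm_le q ⟨hq.1.le, hq.2⟩) (Real.rpow_nonneg hq.1.le _)

theorem norm_singularAmplitudeDeriv_le (h : IsC1Amplitude L M w w') {μ : ℝ} (h0 : 0 < μ)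
    (h1 : μ < 1) {q : ℝ} (hq : q ∈ Ioc 0 L) :
    ‖singularAmplitudeDeriv μ w w' q‖ ≤ M * (1 + L) * q ^ (μ - 2) := by
  have hq' : q ∈ Icc 0 L := ⟨hq.1.le, hq.2⟩
  have hp := Real.rpow_pos_of_pos hq.1 (μ - 2)
  have hM : 0 ≤ M := h.nonneg (hq.1.le.trans hq.2)
  have e : q ^ (μ - 1) = q * q ^ (μ - 2) := by
    rw [show μ - 1 = 1 + (μ - 2) by ring, Real.rpow_add hq.1, Real.rpow_one]
  have e1 : |μ - 1| ≤ 1 := abs_le.2 ⟨by linarith, by linarith⟩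
  refine (norm_add_le _ _).trans ?_
  rw [norm_mul, norm_mul, Complex.norm_real, Complex.norm_real, e, norm_mul, norm_mul,
    Real.norm_of_nonneg hp.le, Real.norm_eq_abs, Real.norm_of_nonneg hq.1.le]
  calc _ ≤ 1 * q ^ (μ - 2) * M + L * q ^ (μ - 2) * M := by
        refine add_le_add (mul_le_mul (mul_le_mul_of_nonneg_right e1 hp.le) (h.norm_le q hq')
          (norm_nonneg _) (by positivity)) (mul_le_mul (mul_le_mul_of_nonneg_right hq.2 hp.le)
          (h.norm_deriv_le q hq') (norm_nonneg _) (mul_nonneg (hq'.1.trans hq'.2) hp.le))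
    _ = _ := by ring

/-- Contribution of the part of the integral to the right of the stationary point. -/
theorem norm_integral_right_sub_le (h : IsC1Amplitude L M w w') {μ t s : ℝ} (h0 : 0 < μ)
    (h1 : μ < 1) (ht : 0 < t) (hs : 0 < s) (hsL : 2 * s ≤ L) :
    ‖(∫ q in s..L, singularAmplitude μ w q * Complex.exp (-Complex.I * (t * (q - s) ^ 2 : ℝ))) -
        singularAmplitude μ w s * fresnelTail t 0‖ ≤
      M * (1 + L) * (2 + 1 / (1 - μ)) * (t ^ (-(3 / 4) : ℝ) * s ^ (μ - 3 / 2)) := by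
  have hM : 0 ≤ M := h.nonneg (by linarith)
  have hsL' : s ≤ L := by linarith
  have hsub : uIcc s L ⊆ Ioc 0 L := by
    rw [uIcc_of_le hsL']; exact fun q hq => ⟨hs.trans_le hq.1, hq.2⟩
  have hF : ContinuousOn (fun q => fresnelTail t (q - s)) (Icc s L) :=
    (continuousOn_fresnelTail ht).comp (by fun_prop) fun q hq => sub_nonneg.2 hq.1
  have hFd : ∀ q ∈ Ioi s, HasDerivAt (fun q => -fresnelTail t (q - s))
      (Complex.exp (-Complex.I * (t * (q - s) ^ 2 : ℝ))) q := by
    intro q hq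
    have := ((hasDerivAt_fresnelTail ht (sub_pos.2 hq)).comp_sub_const q s).neg
    rwa [neg_neg] at this
  have hparts := intervalIntegral.integral_mul_deriv_eq_deriv_mul_of_hasDerivAt
    (u := singularAmplitude μ w) (v := fun q => -fresnelTail t (q - s))
    (u' := singularAmplitudeDeriv μ w w')
    (v' := fun q => Complex.exp (-Complex.I * (t * (q - s) ^ 2 : ℝ))) (a := s) (b := L)
    ((h.continuousOn_singularAmplitude μ).mono hsub)
    (by rw [uIcc_of_le hsL']; exact hF.neg)
    (fun q hq => by
      rw [min_eq_left hsL', max_eq_right hsL'] at hq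
      exact h.hasDerivAt_singularAmplitude μ ⟨hs.trans hq.1, hq.2⟩)
    (fun q hq => by
      rw [min_eq_left hsL', max_eq_right hsL'] at hq
      exact hFd q hq.1)
    ((h.continuousOn_singularAmplitudeDeriv μ).mono hsub).intervalIntegrable
    (Continuous.intervalIntegrable (by fun_prop) _ _)
  have hL0 : singularAmplitude μ w L = 0 := by rw [singularAmplitude, h.right_eq_zero, mul_zero]
  have hint : ∀ a b, s ≤ a → a ≤ b → b ≤ L → IntervalIntegrable
      (fun q => singularAmplitudeDeriv μ w w' q * -fresnelTail t (q - s)) volume a b := by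
    intro a b ha hab hb
    refine ContinuousOn.intervalIntegrable ?_
    rw [uIcc_of_le hab]
    exact ((h.continuousOn_singularAmplitudeDeriv μ).mono fun q hq =>
        ⟨hs.trans_le (ha.trans hq.1), hq.2.trans hb⟩).mul
      (hF.mono fun q hq => ⟨ha.trans hq.1, hq.2.trans hb⟩).neg
  have hb : ∀ q ∈ Ioc s L, ‖singularAmplitudeDeriv μ w w' q * -fresnelTail t (q - s)‖ ≤
      M * (1 + L) * q ^ (μ - 2) * (t ^ (-(3 / 4) : ℝ) * (q - s) ^ (-(1 / 2) : ℝ)) := by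
    intro q hq
    rw [norm_mul, norm_neg]
    have hq0 : 0 < q := hs.trans hq.1
    exact mul_le_mul (h.norm_singularAmplitudeDeriv_le h0 h1 ⟨hq0, hq.2⟩)
      (norm_fresnelTail_le_rpow ht (sub_pos.2 hq.1)) (norm_nonneg _)
      (mul_nonneg (mul_nonneg hM (by linarith)) (Real.rpow_nonneg hq0.le _))
  have ht34 := Real.rpow_pos_of_pos ht (-(3 / 4))
  -- Here `q^(μ-2) ≤ s^(μ-2)`, and integrating `(q - s)^(-1/2)` gives `2 s^(1/2)`.
  have near : ‖∫ q in s..(2 * s), singularAmplitudeDeriv μ w w' q * -fresnelTail t (q - s)‖ ≤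
      M * (1 + L) * 2 * (t ^ (-(3 / 4) : ℝ) * s ^ (μ - 3 / 2)) := by
    have hi : IntervalIntegrable (fun q => M * (1 + L) * s ^ (μ - 2) * t ^ (-(3 / 4) : ℝ) *
        (q - s) ^ (-(1 / 2) : ℝ)) volume s (2 * s) := by
      have := (intervalIntegral.intervalIntegrable_rpow' (a := s - s) (b := 2 * s - s)
        (show (-1 : ℝ) < -(1 / 2) by norm_num)).comp_sub_right s
      simp only [sub_add_cancel] at this
      exact this.const_mul _
    refine (intervalIntegral.norm_integral_le_of_norm_le (by linarith) (ae_of_all _ fun q hq => ?_)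
      hi).trans_eq ?_
    · refine (hb q ⟨hq.1, hq.2.trans hsL⟩).trans ?_
      rw [← mul_assoc]
      refine mul_le_mul_of_nonneg_right (mul_le_mul_of_nonneg_right ?_ ht34.le)
        (Real.rpow_nonneg (sub_nonneg.2 hq.1.le) _)
      exact mul_le_mul_of_nonneg_left (Real.rpow_le_rpow_of_nonpos hs hq.1.le (by linarith))
        (mul_nonneg hM (by linarith))
    · rw [intervalIntegral.integral_const_mul,
        intervalIntegral.integral_comp_sub_right (fun q => q ^ (-(1 / 2) : ℝ)) s,
        integral_rpow (Or.inl (by norm_num)), sub_self, show 2 * s - s = s by ring,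
        Real.zero_rpow (by norm_num),
        show μ - 3 / 2 = (μ - 2) + (-(1 / 2) + 1) by ring, Real.rpow_add hs (μ - 2)]
      ring
  -- Here `q - s ≥ s`, so the Fresnel factor is frozen and `q^(μ-2)` is integrated instead.
  have far : ‖∫ q in (2 * s)..L, singularAmplitudeDeriv μ w w' q * -fresnelTail t (q - s)‖ ≤
      M * (1 + L) * (1 / (1 - μ)) * (t ^ (-(3 / 4) : ℝ) * s ^ (μ - 3 / 2)) := by
    have h0n : (0 : ℝ) ∉ uIcc (2 * s) L := by
      rw [uIcc_of_le hsL]; exact fun hh => by linarith [hh.1]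
    have hi : IntervalIntegrable (fun q => M * (1 + L) * s ^ (-(1 / 2) : ℝ) * t ^ (-(3 / 4) : ℝ) *
        q ^ (μ - 2)) volume (2 * s) L :=
      (intervalIntegral.intervalIntegrable_rpow (Or.inr h0n)).const_mul _
    refine (intervalIntegral.norm_integral_le_of_norm_le hsL (ae_of_all _ fun q hq => ?_)
      hi).trans ?_
    · refine (hb q ⟨by linarith [hq.1], hq.2⟩).trans ?_
      have hq0 : 0 < q := by linarith [hq.1]
      have := Real.rpow_le_rpow_of_nonpos hs (show s ≤ q - s by linarith [hq.1])
        (show -(1 / 2 : ℝ) ≤ 0 by norm_num)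
      calc _ = M * (1 + L) * t ^ (-(3 / 4) : ℝ) * q ^ (μ - 2) * (q - s) ^ (-(1 / 2) : ℝ) := by ring
        _ ≤ M * (1 + L) * t ^ (-(3 / 4) : ℝ) * q ^ (μ - 2) * s ^ (-(1 / 2) : ℝ) :=
          mul_le_mul_of_nonneg_left this (mul_nonneg (mul_nonneg (mul_nonneg hM (by linarith))
            ht34.le) (Real.rpow_nonneg hq0.le _))
        _ = _ := by ring
    · rw [intervalIntegral.integral_const_mul, integral_rpow (Or.inr ⟨by linarith, h0n⟩)]
      have e1 : μ - 2 + 1 = -(1 - μ) := by ring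
      have e2 : s ^ (μ - 3 / 2) = s ^ (-(1 / 2) : ℝ) * s ^ (-(1 - μ)) := by
        rw [← Real.rpow_add hs]; congr 1; ring
      have e3 : (2 * s) ^ (-(1 - μ)) ≤ s ^ (-(1 - μ)) :=
        Real.rpow_le_rpow_of_nonpos hs (by linarith) (by linarith)
      have e4 : 0 ≤ L ^ (-(1 - μ)) := Real.rpow_nonneg (by linarith) _
      have e5 : (L ^ (-(1 - μ)) - (2 * s) ^ (-(1 - μ))) / (-(1 - μ)) ≤
          1 / (1 - μ) * s ^ (-(1 - μ)) := by
        rw [div_neg, ← neg_div, neg_sub, one_div_mul_eq_div]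
        exact div_le_div_of_nonneg_right (by linarith) (by linarith)
      rw [e1, e2]
      calc _ ≤ M * (1 + L) * s ^ (-(1 / 2) : ℝ) * t ^ (-(3 / 4) : ℝ) *
            (1 / (1 - μ) * s ^ (-(1 - μ))) :=
          mul_le_mul_of_nonneg_left e5 (mul_nonneg (mul_nonneg (mul_nonneg hM (by linarith))
            (Real.rpow_nonneg hs.le _)) ht34.le)
        _ = _ := by ring
  rw [hparts, hL0, zero_mul, sub_self, mul_neg, sub_neg_eq_add, zero_add,
    sub_sub_cancel_left, norm_neg,
    ← intervalIntegral.integral_add_adjacent_intervals (hint s (2 * s) le_rfl (by linarith) hsL)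
      (hint (2 * s) L (by linarith) hsL le_rfl)]
  refine (norm_add_le _ _).trans ((add_le_add near far).trans_eq ?_)
  ring

/-- Contribution of the part of the integral between the singularity and the stationary point. -/
theorem norm_integral_middle_sub_le (h : IsC1Amplitude L M w w') {μ t s σ : ℝ} (h0 : 0 < μ)
    (h1 : μ < 1) (ht : 0 < t) (hσ : 0 < σ) (hσs : 2 * σ ≤ s) (hsL : 2 * s ≤ L) :
    ‖(∫ q in σ..s, singularAmplitude μ w q * Complex.exp (-Complex.I * (t * (q - s) ^ 2 : ℝ))) -
        singularAmplitude μ w s * fresnelTail t 0‖ ≤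
      M * (1 + L) * 8 * (t ^ (-(3 / 4) : ℝ) * s ^ (μ - 3 / 2)) +
        M * (1 + L) * (1 + 1 / (1 - μ)) * (σ ^ (μ - 1) / (t * s)) := by
  have hs : 0 < s := by linarith
  have hM : 0 ≤ M := h.nonneg (by linarith)
  have hsL' : σ ≤ s := by linarith
  have hsub : uIcc σ s ⊆ Ioc 0 L := by
    rw [uIcc_of_le hsL']; exact fun q hq => ⟨hσ.trans_le hq.1, by linarith [hq.2]⟩
  have hF : ContinuousOn (fun q => fresnelTail t (s - q)) (Icc σ s) :=
    (continuousOn_fresnelTail ht).comp (by fun_prop) fun q hq => sub_nonneg.2 hq.2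
  have hFd : ∀ q ∈ Iio s, HasDerivAt (fun q => fresnelTail t (s - q))
      (Complex.exp (-Complex.I * (t * (q - s) ^ 2 : ℝ))) q := by
    intro q hq
    have := (hasDerivAt_fresnelTail ht (sub_pos.2 hq)).comp_const_sub s q
    rwa [neg_neg, show (s - q) ^ 2 = (q - s) ^ 2 by ring] at this
  have hparts := intervalIntegral.integral_mul_deriv_eq_deriv_mul_of_hasDerivAt
    (u := singularAmplitude μ w) (v := fun q => fresnelTail t (s - q))
    (u' := singularAmplitudeDeriv μ w w')
    (v' := fun q => Complex.exp (-Complex.I * (t * (q - s) ^ 2 : ℝ))) (a := σ) (b := s)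
    ((h.continuousOn_singularAmplitude μ).mono hsub)
    (by rw [uIcc_of_le hsL']; exact hF)
    (fun q hq => by
      rw [min_eq_left hsL', max_eq_right hsL'] at hq
      exact h.hasDerivAt_singularAmplitude μ ⟨hσ.trans hq.1, by linarith [hq.2]⟩)
    (fun q hq => by
      rw [min_eq_left hsL', max_eq_right hsL'] at hq
      exact hFd q hq.2)
    ((h.continuousOn_singularAmplitudeDeriv μ).mono hsub).intervalIntegrable
    (Continuous.intervalIntegrable (by fun_prop) _ _)
  have ht34 := Real.rpow_pos_of_pos ht (-(3 / 4))
  have hML : 0 ≤ M * (1 + L) := mul_nonneg hM (by linarith)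
  have hts : 0 < t * s := mul_pos ht hs
  have h0n : (0 : ℝ) ∉ uIcc σ s := fun hh => (hsub hh).1.ne' rfl
  have tail : ‖∫ q in σ..s, singularAmplitudeDeriv μ w w' q * fresnelTail t (s - q)‖ ≤
      M * (1 + L) * 8 * (t ^ (-(3 / 4) : ℝ) * s ^ (μ - 3 / 2)) +
        M * (1 + L) * (1 / (1 - μ)) * (σ ^ (μ - 1) / (t * s)) := by
    have hi1 : IntervalIntegrable (fun q => M * (1 + L) * (s / 2) ^ (μ - 2) * t ^ (-(3 / 4) : ℝ) *
        (s - q) ^ (-(1 / 2) : ℝ)) volume σ s := by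
      have := (intervalIntegral.intervalIntegrable_rpow' (a := s - σ) (b := s - s)
        (show (-1 : ℝ) < -(1 / 2) by norm_num)).comp_sub_left s
      simp only [sub_sub_cancel] at this
      exact this.const_mul _
    have hi2 : IntervalIntegrable (fun q => M * (1 + L) * (1 / (t * s)) * q ^ (μ - 2))
        volume σ s :=
      (intervalIntegral.intervalIntegrable_rpow (Or.inr h0n)).const_mul _
    -- One majorant serves all of `[σ, s]`: its first summand controls `q ≥ s/2`, where the Fresnel
    -- tail is only integrable, and its second `q ≤ s/2`, where the tail is at most `1/(ts)`.
    refine (intervalIntegral.norm_integral_le_of_norm_le hsL' ?_ (hi1.add hi2)).trans ?_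
    · have hne : ∀ᵐ q : ℝ, q ≠ s := by
        simp [ae_iff]
      filter_upwards [hne] with q hqs hq
      have hq0 : 0 < q := hσ.trans hq.1
      have hqs' : 0 < s - q := sub_pos.2 (lt_of_le_of_ne hq.2 hqs)
      have hψ := h.norm_singularAmplitudeDeriv_le h0 h1 ⟨hq0, show q ≤ L by linarith [hq.2]⟩
      have hq2 := Real.rpow_nonneg hq0.le (μ - 2)
      have hs2 := Real.rpow_nonneg hqs'.le (-(1 / 2) : ℝ)
      have hs3 := Real.rpow_nonneg (show 0 ≤ s / 2 by linarith) (μ - 2)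
      rw [norm_mul]
      refine (mul_le_mul_of_nonneg_right hψ (norm_nonneg _)).trans ?_
      rcases le_total q (s / 2) with hc | hc
      · have h2 : ‖fresnelTail t (s - q)‖ ≤ 1 / (t * s) := by
          refine (norm_fresnelTail_le_inv ht hqs').trans ?_
          exact one_div_le_one_div_of_le hts (by nlinarith)
        refine le_add_of_nonneg_of_le (by positivity) ?_
        exact (mul_le_mul_of_nonneg_left h2 (mul_nonneg hML hq2)).trans_eq (by ring)
      · refine le_add_of_le_of_nonneg ?_ (by positivity)
        have h3 : q ^ (μ - 2) ≤ (s / 2) ^ (μ - 2) :=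
          Real.rpow_le_rpow_of_nonpos (by linarith) hc (by linarith)
        calc _ ≤ M * (1 + L) * (s / 2) ^ (μ - 2) * (t ^ (-(3 / 4) : ℝ) * (s - q) ^ (-(1 / 2) : ℝ)) :=
              mul_le_mul (mul_le_mul_of_nonneg_left h3 hML) (norm_fresnelTail_le_rpow ht hqs')
                (norm_nonneg _) (mul_nonneg hML hs3)
          _ = _ := by ring
    · rw [intervalIntegral.integral_add hi1 hi2]
      refine add_le_add ?_ ?_
      · rw [intervalIntegral.integral_const_mul,
          intervalIntegral.integral_comp_sub_left (fun q => q ^ (-(1 / 2) : ℝ)) s,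
          integral_rpow (Or.inl (by norm_num)), sub_self,
          Real.zero_rpow (by norm_num),
          show μ - 3 / 2 = (μ - 2) + (-(1 / 2) + 1) by ring, Real.rpow_add hs (μ - 2)]
        -- The factor `4`, with the `2` from integrating the square-root singularity, produces the
        -- constant `8`.
        have e1 : (s / 2) ^ (μ - 2) ≤ 4 * s ^ (μ - 2) := by
          rw [Real.div_rpow hs.le (by norm_num), div_eq_mul_inv, ← Real.rpow_neg (by norm_num),
            mul_comm]
          refine mul_le_mul_of_nonneg_right ?_ (Real.rpow_nonneg hs.le _)
          refine (Real.rpow_le_rpow_of_exponent_le (by norm_num) (show -(μ - 2) ≤ (2 : ℝ) by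
            linarith)).trans_eq ?_
          norm_num
        have e2 : (s - σ) ^ (-(1 / 2) + 1 : ℝ) ≤ s ^ (-(1 / 2) + 1 : ℝ) :=
          Real.rpow_le_rpow (by linarith) (by linarith) (by norm_num)
        calc _ = M * (1 + L) * 2 * t ^ (-(3 / 4) : ℝ) *
              ((s / 2) ^ (μ - 2) * (s - σ) ^ (-(1 / 2) + 1 : ℝ)) := by ring
          _ ≤ M * (1 + L) * 2 * t ^ (-(3 / 4) : ℝ) *
              (4 * s ^ (μ - 2) * s ^ (-(1 / 2) + 1 : ℝ)) := by
            refine mul_le_mul_of_nonneg_left (mul_le_mul e1 e2 (Real.rpow_nonneg (by linarith) _)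
              (by positivity)) (by positivity)
          _ = _ := by ring
      · rw [intervalIntegral.integral_const_mul, integral_rpow (Or.inr ⟨by linarith, h0n⟩)]
        have e1 : μ - 2 + 1 = μ - 1 := by ring
        have e4 : 0 ≤ s ^ (μ - 1) := Real.rpow_nonneg hs.le _
        have e5 : (s ^ (μ - 1) - σ ^ (μ - 1)) / (μ - 1) ≤ 1 / (1 - μ) * σ ^ (μ - 1) := by
          rw [← neg_sub 1 μ, div_neg, ← neg_div, neg_sub, one_div_mul_eq_div, neg_sub]
          exact div_le_div_of_nonneg_right (by linarith) (by linarith)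
        rw [e1]
        calc _ ≤ M * (1 + L) * (1 / (t * s)) * (1 / (1 - μ) * σ ^ (μ - 1)) :=
            mul_le_mul_of_nonneg_left e5 (by positivity)
          _ = _ := by ring
  have bdry : ‖singularAmplitude μ w σ * fresnelTail t (s - σ)‖ ≤
      M * (1 + L) * (σ ^ (μ - 1) / (t * s)) := by
    rw [norm_mul]
    have h2 : ‖fresnelTail t (s - σ)‖ ≤ 1 / (t * s) := by
      refine (norm_fresnelTail_le_inv ht (by linarith)).trans ?_
      exact one_div_le_one_div_of_le hts (by nlinarith)
    have h3 := Real.rpow_nonneg hσ.le (μ - 1)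
    calc _ ≤ M * σ ^ (μ - 1) * (1 / (t * s)) :=
          mul_le_mul (h.norm_singularAmplitude_le μ ⟨hσ, by linarith⟩) h2 (norm_nonneg _)
            (mul_nonneg hM h3)
      _ = M * (σ ^ (μ - 1) / (t * s)) := by ring
      _ ≤ _ := by
        refine mul_le_mul_of_nonneg_right ?_ (by positivity)
        nlinarith
  have e : ∀ a b c : ℂ, a - b - c - a = -(b + c) := fun a b c => by ring
  rw [hparts, sub_self, e, norm_neg]
  refine (norm_add_le _ _).trans ((add_le_add bdry tail).trans_eq ?_)
  ring

/-- Contribution of the singularity at the origin. -/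
theorem norm_integral_left_sub_le (h : IsC1Amplitude L M w w') {μ t s σ : ℝ} (h0 : 0 < μ)
    (h1 : μ < 1) (ht : 0 < t) (hσ : 0 < σ) (htσ : t * σ ^ 2 = 1) (hσ1 : σ ≤ 1) (hs : 0 < s)
    (hσL : σ ≤ L) :
    ‖(∫ q in (0 : ℝ)..σ,
          singularAmplitude μ w q * Complex.exp (-Complex.I * (t * (q - s) ^ 2 : ℝ))) -
        Complex.exp (-Complex.I * (t * s ^ 2 : ℝ)) *
          (w 0 * (((2 * t * s) ^ (-μ) : ℝ) * oscGamma μ 0))‖ ≤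
      M * (1 + 3 / μ) * (σ ^ (μ - 1) / (t * s)) := by
  have hM : 0 ≤ M := h.nonneg (by linarith)
  have hk : 0 < 2 * t * s := by positivity
  have hts : 0 < t * s := by positivity
  have hsub : uIcc 0 σ ⊆ Icc 0 L := by
    rw [uIcc_of_le hσ.le]; exact fun q hq => ⟨hq.1, hq.2.trans hσL⟩
  have hgauss : ∀ q : ℝ, HasDerivAt (fun q : ℝ => Complex.exp (-Complex.I * (t * q ^ 2 : ℝ)))
      (Complex.exp (-Complex.I * (t * q ^ 2 : ℝ)) * (-Complex.I * (2 * t * q : ℝ))) q := by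
    intro q
    have h2 := (((hasDerivAt_pow 2 q).const_mul t).ofReal_comp.const_mul (-Complex.I)).cexp
    refine h2.congr_deriv ?_
    push_cast
    ring
  -- Expanding `(q - s)² = q² - 2qs + s²` leaves the linear phase `2tsq`, which has no stationary
  -- point; `e^{-itq²}` varies slowly for `q ≤ σ` and is differentiated with `w`.
  have hparts := intervalIntegral.integral_mul_deriv_eq_deriv_mul_of_hasDerivAt
    (u := fun q => w q * Complex.exp (-Complex.I * (t * q ^ 2 : ℝ)))
    (v := powExpPrimitive μ (2 * t * s))
    (u' := fun q => w' q * Complex.exp (-Complex.I * (t * q ^ 2 : ℝ)) +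
      w q * (Complex.exp (-Complex.I * (t * q ^ 2 : ℝ)) * (-Complex.I * (2 * t * q : ℝ))))
    (v' := fun q => ((q ^ (μ - 1) : ℝ) : ℂ) * Complex.exp (Complex.I * (2 * t * s * q : ℝ)))
    (a := 0) (b := σ)
    ((h.continuousOn.mono hsub).mul (by fun_prop))
    ((continuousOn_powExpPrimitive h0 h1.le hk).mono (hsub.trans Icc_subset_Ici_self))
    (fun q hq => by
      rw [min_eq_left hσ.le, max_eq_right hσ.le] at hq
      exact (h.hasDerivAt q ⟨hq.1, hq.2.trans_le hσL⟩).mul (hgauss q))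
    (fun q hq => by
      rw [min_eq_left hσ.le, max_eq_right hσ.le] at hq
      exact hasDerivAt_powExpPrimitive h1.le hk hq.1)
    (ContinuousOn.intervalIntegrable (((h.continuousOn_deriv.mono hsub).mul (by fun_prop)).add
      ((h.continuousOn.mono hsub).mul (by fun_prop))))
    ((intervalIntegrable_ofReal_rpow (by linarith) _ _).mul_continuousOn
      (by fun_prop))
  have hcongr : (∫ q in (0 : ℝ)..σ,
        singularAmplitude μ w q * Complex.exp (-Complex.I * (t * (q - s) ^ 2 : ℝ))) =
      Complex.exp (-Complex.I * (t * s ^ 2 : ℝ)) * ∫ q in (0 : ℝ)..σ,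
        w q * Complex.exp (-Complex.I * (t * q ^ 2 : ℝ)) *
          (((q ^ (μ - 1) : ℝ) : ℂ) * Complex.exp (Complex.I * (2 * t * s * q : ℝ))) := by
    rw [← intervalIntegral.integral_const_mul]
    refine intervalIntegral.integral_congr fun q _ => ?_
    have : Complex.exp (-Complex.I * (t * (q - s) ^ 2 : ℝ)) =
        Complex.exp (-Complex.I * (t * s ^ 2 : ℝ)) * (Complex.exp (-Complex.I * (t * q ^ 2 : ℝ)) *
          Complex.exp (Complex.I * (2 * t * s * q : ℝ))) := by
      rw [← Complex.exp_add, ← Complex.exp_add]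
      congr 1
      push_cast
      ring
    simp only [singularAmplitude, this]
    ring
  have hunit : ∀ x : ℝ, ‖Complex.exp (-Complex.I * (x : ℝ))‖ = 1 := fun x => by
    rw [show -Complex.I * (x : ℂ) = ((-x : ℝ) : ℂ) * Complex.I by push_cast; ring,
      Complex.norm_exp_ofReal_mul_I]
  have hσμ := Real.rpow_nonneg hσ.le (μ - 1)
  have hprim : ∀ q, 0 < q → ‖powExpPrimitive μ (2 * t * s) q‖ ≤ q ^ (μ - 1) / (t * s) :=
    fun q hq => (norm_powExpPrimitive_le h1.le hk hq).trans
      (div_le_div_of_nonneg_left (Real.rpow_nonneg hq.le _) hts (by linarith))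
  have bdry : ‖w σ * Complex.exp (-Complex.I * (t * σ ^ 2 : ℝ)) *
      powExpPrimitive μ (2 * t * s) σ‖ ≤ M * (σ ^ (μ - 1) / (t * s)) := by
    rw [norm_mul, norm_mul, hunit, mul_one]
    exact mul_le_mul (h.norm_le σ ⟨hσ.le, hσL⟩) (hprim σ hσ) (norm_nonneg _) hM
  have tail : ‖∫ q in (0 : ℝ)..σ, (w' q * Complex.exp (-Complex.I * (t * q ^ 2 : ℝ)) +
      w q * (Complex.exp (-Complex.I * (t * q ^ 2 : ℝ)) * (-Complex.I * (2 * t * q : ℝ)))) *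
        powExpPrimitive μ (2 * t * s) q‖ ≤ M * (3 / μ) * (σ ^ (μ - 1) / (t * s)) := by
    -- From `t * σ ^ 2 = 1` and `σ ≤ 1`, both `tq` and `1` are at most `1/σ`; hence one `M/σ` from
    -- `w'` and two from the Gaussian.
    have hi : IntervalIntegrable (fun q => 3 * M / σ * (1 / (t * s)) * q ^ (μ - 1)) volume 0 σ :=
      (intervalIntegral.intervalIntegrable_rpow' (by linarith)).const_mul _
    refine (intervalIntegral.norm_integral_le_of_norm_le hσ.le (ae_of_all _ fun q hq => ?_)
      hi).trans_eq ?_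
    · have hqL : q ∈ Icc 0 L := ⟨hq.1.le, hq.2.trans hσL⟩
      have htq : t * q ≤ 1 / σ := by
        rw [le_div_iff₀ hσ, ← htσ]
        nlinarith [mul_nonneg ht.le hσ.le, hq.2]
      have h1σ : 1 ≤ 1 / σ := by rwa [le_div_iff₀ hσ, one_mul]
      have hu : ‖w' q * Complex.exp (-Complex.I * (t * q ^ 2 : ℝ)) +
          w q * (Complex.exp (-Complex.I * (t * q ^ 2 : ℝ)) * (-Complex.I * (2 * t * q : ℝ)))‖ ≤
          3 * M / σ := by
        refine (norm_add_le _ _).trans ?_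
        rw [norm_mul, norm_mul, norm_mul, norm_mul, hunit, norm_neg, Complex.norm_I, mul_one,
          one_mul, one_mul, Complex.norm_real,
          Real.norm_of_nonneg (mul_nonneg (by positivity) hq.1.le)]
        calc _ ≤ M * (1 / σ) + M * (2 * (1 / σ)) := by
              refine add_le_add ((h.norm_deriv_le q hqL).trans (le_mul_of_one_le_right hM h1σ))
                (mul_le_mul (h.norm_le q hqL) (by linarith)
                  (mul_nonneg (by positivity) hq.1.le) hM)
          _ = _ := by ring
      rw [norm_mul]
      exact (mul_le_mul hu (hprim q hq.1) (norm_nonneg _) (by positivity)).trans_eq (by ring)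
    · rw [intervalIntegral.integral_const_mul, integral_rpow (Or.inl (by linarith)),
        sub_add_cancel, Real.zero_rpow h0.ne', sub_zero, Real.rpow_sub_one hσ.ne']
      field_simp
  have hzero : powExpPrimitive μ (2 * t * s) 0 =
      -(((2 * t * s) ^ (-μ) : ℝ) * oscGamma μ 0) := by rw [powExpPrimitive, mul_zero]
  rw [hcongr, hparts, hzero, ← mul_sub, norm_mul, hunit, one_mul, zero_pow two_ne_zero, mul_zero,
    Complex.ofReal_zero, mul_zero, Complex.exp_zero, mul_one, mul_neg, sub_neg_eq_add]
  have e : ∀ a b c : ℂ, a + b - c - b = a - c := fun a b c => by ring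
  rw [e]
  refine (norm_sub_le _ _).trans ((add_le_add bdry tail).trans_eq ?_)
  ring

theorem intervalIntegrable_singularAmplitude_mul (h : IsC1Amplitude L M w w') {μ : ℝ}
    (h0 : 0 < μ) {g : ℝ → ℂ} (hg : Continuous g) {a b : ℝ} (ha : 0 ≤ a) (hab : a ≤ b)
    (hb : b ≤ L) :
    IntervalIntegrable (fun q => singularAmplitude μ w q * g q) volume a b := by
  have hsub : uIcc a b ⊆ Icc 0 L := by
    rw [uIcc_of_le hab]; exact Icc_subset_Icc ha hb
  exact ((intervalIntegrable_ofReal_rpow (by linarith) _ _).mul_continuousOn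
    (h.continuousOn.mono hsub)).mul_continuousOn hg.continuousOn

/-- Two-term asymptotics of the oscillatory integral with a stationary point `s` approaching the
singularity of the amplitude at the origin. -/
theorem norm_integral_sub_le (h : IsC1Amplitude L M w w') {μ t s σ : ℝ} (h0 : 0 < μ)
    (h1 : μ < 1) (ht : 0 < t) (hσ : 0 < σ) (htσ : t * σ ^ 2 = 1) (hσ1 : σ ≤ 1)
    (hσs : 2 * σ ≤ s) (hsL : 2 * s ≤ L) :
    ‖(∫ q in (0 : ℝ)..L,
          singularAmplitude μ w q * Complex.exp (-Complex.I * (t * (q - s) ^ 2 : ℝ))) -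
        (Complex.exp (-Complex.I * (t * s ^ 2 : ℝ)) *
            (w 0 * (((2 * t * s) ^ (-μ) : ℝ) * oscGamma μ 0)) +
          singularAmplitude μ w s * (2 * fresnelTail t 0))‖ ≤
      M * (1 + L) * (10 + 1 / (1 - μ)) * (t ^ (-(3 / 4) : ℝ) * s ^ (μ - 3 / 2)) +
        (M * (1 + L) * (1 + 1 / (1 - μ)) + M * (1 + 3 / μ)) * (σ ^ (μ - 1) / (t * s)) := by
  have hs : 0 < s := by linarith
  have hg : Continuous fun q : ℝ => Complex.exp (-Complex.I * (t * (q - s) ^ 2 : ℝ)) := by fun_prop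
  have i1 := h.intervalIntegrable_singularAmplitude_mul h0 hg le_rfl hσ.le (by linarith)
  have i2 := h.intervalIntegrable_singularAmplitude_mul h0 hg (a := σ) (b := s) hσ.le
    (by linarith) (by linarith)
  have i3 := h.intervalIntegrable_singularAmplitude_mul h0 hg (a := s) (b := L) hs.le
    (by linarith) le_rfl
  rw [← intervalIntegral.integral_add_adjacent_intervals (i1.trans i2) i3,
    ← intervalIntegral.integral_add_adjacent_intervals i1 i2]
  have e : ∀ A B C a b : ℂ, A + B + C - (a + b * (2 * fresnelTail t 0)) =
      (A - a) + (B - b * fresnelTail t 0) + (C - b * fresnelTail t 0) := fun A B C a b => by ring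
  rw [e]
  refine (norm_add₃_le).trans ((add_le_add_three
    (h.norm_integral_left_sub_le h0 h1 ht hσ htσ hσ1 hs (by linarith))
    (h.norm_integral_middle_sub_le h0 h1 ht hσ hσs hsL)
    (h.norm_integral_right_sub_le h0 h1 ht hs hsL)).trans_eq ?_)
  ring

end IsC1Amplitude

/-! ### The Fourier transform in angular frequency on Schwartz space. -/

/-- The dilation `x ↦ x / (2π)` of the line. -/
def angularScaling : ℝ ≃L[ℝ] ℝ :=
  ContinuousLinearEquiv.unitsEquivAut ℝ (Units.mk0 (2 * Real.pi)⁻¹ (by positivity))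

/-- The Fourier transform `x ↦ ∫ χ(p) e^{-ixp} dp` on Schwartz space. -/
def angularFourier (χ : SchwartzMap ℝ ℂ) : SchwartzMap ℝ ℂ :=
  SchwartzMap.compCLMOfContinuousLinearEquiv ℂ angularScaling (𝓕 χ)

theorem angularFourier_eq_fourier (χ : SchwartzMap ℝ ℂ) (x : ℝ) :
    angularFourier χ x = 𝓕 (χ : ℝ → ℂ) (x * (2 * Real.pi)⁻¹) := rfl

theorem angularFourier_apply (χ : SchwartzMap ℝ ℂ) (x : ℝ) :
    angularFourier χ x = ∫ p : ℝ, χ p * Complex.exp (-Complex.I * x * p) := by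
  rw [angularFourier_eq_fourier, Real.fourier_real_eq_integral_exp_smul]
  refine integral_congr_ae (ae_of_all _ fun p => ?_)
  have hπ : (Real.pi : ℂ) ≠ 0 := Complex.ofReal_ne_zero.2 Real.pi_ne_zero
  simp only [smul_eq_mul]
  rw [mul_comm]
  congr 2
  push_cast
  field_simp

/-- Multiplication by the variable on Schwartz space. -/
def mulVar (χ : SchwartzMap ℝ ℂ) : SchwartzMap ℝ ℂ :=
  SchwartzMap.smulLeftCLM ℂ (fun p : ℝ => (p : ℂ)) χ

theorem mulVar_apply (χ : SchwartzMap ℝ ℂ) (p : ℝ) : mulVar χ p = p * χ p := by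
  rw [mulVar, SchwartzMap.smulLeftCLM_apply_apply (by fun_prop), smul_eq_mul]

theorem hasDerivAt_angularFourier (χ : SchwartzMap ℝ ℂ) (x : ℝ) :
    HasDerivAt (angularFourier χ) (-Complex.I * angularFourier (mulVar χ) x) x := by
  have hX : Integrable fun p : ℝ => p • χ p := by
    refine (mulVar χ).integrable.congr (ae_of_all _ fun p => ?_)
    simp only [mulVar_apply, Complex.real_smul]
  have h1 := Real.hasDerivAt_fourier χ.integrable hX (x * (2 * Real.pi)⁻¹)
  have h2 : HasDerivAt (fun x : ℝ => x * (2 * Real.pi)⁻¹) (2 * Real.pi)⁻¹ x := by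
    simpa using (hasDerivAt_id x).mul_const (2 * Real.pi)⁻¹
  have h3 := h1.scomp x h2
  refine h3.congr_deriv ?_
  rw [angularFourier_eq_fourier, Real.fourier_real_eq_integral_exp_smul,
    Real.fourier_real_eq_integral_exp_smul, Complex.real_smul, ← integral_const_mul,
    ← integral_const_mul]
  refine integral_congr_ae (ae_of_all _ fun p => ?_)
  have hπ : (Real.pi : ℂ) ≠ 0 := Complex.ofReal_ne_zero.2 Real.pi_ne_zero
  simp only [smul_eq_mul, mulVar_apply]
  push_cast
  field_simp

theorem iteratedDeriv_two_angularFourier (χ : SchwartzMap ℝ ℂ) (x : ℝ) :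
    iteratedDeriv 2 (angularFourier χ) x = -angularFourier (mulVar (mulVar χ)) x := by
  have h1 : deriv (angularFourier χ) = fun x => -Complex.I * angularFourier (mulVar χ) x :=
    funext fun x => (hasDerivAt_angularFourier χ x).deriv
  rw [iteratedDeriv_succ, iteratedDeriv_one, h1,
    ((hasDerivAt_angularFourier (mulVar χ) x).const_mul (-Complex.I)).deriv, ← mul_assoc,
    neg_mul_neg, Complex.I_mul_I, neg_one_mul]

theorem angularFourier_derivCLM (χ : SchwartzMap ℝ ℂ) (x : ℝ) :
    angularFourier (SchwartzMap.derivCLM ℂ ℂ χ) x = Complex.I * x * angularFourier χ x := by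
  have h := congrFun (Real.fourier_deriv χ.integrable χ.differentiable
    (SchwartzMap.derivCLM ℂ ℂ χ).integrable) (x * (2 * Real.pi)⁻¹)
  have hπ : (Real.pi : ℂ) ≠ 0 := Complex.ofReal_ne_zero.2 Real.pi_ne_zero
  rw [angularFourier_eq_fourier, angularFourier_eq_fourier]
  refine h.trans ?_
  rw [smul_eq_mul]
  push_cast
  field_simp

/-! ### Bounds for test functions of compactly supported frequency. -/

/-- `χ` is supported in `[-R, R]` and it and its first two derivatives are bounded by `B`. -/
structure IsTestBound (R B : ℝ) (χ : SchwartzMap ℝ ℂ) : Prop where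
  eq_zero : ∀ p : ℝ, R < |p| → χ p = 0
  norm_le : ∀ p, ‖χ p‖ ≤ B
  norm_deriv_le : ∀ p, ‖deriv χ p‖ ≤ B
  norm_deriv_deriv_le : ∀ p, ‖deriv (deriv χ) p‖ ≤ B

theorem exists_isTestBound (R : ℝ) (χ : SchwartzMap ℝ ℂ) (h : ∀ p : ℝ, R < |p| → χ p = 0) :
    ∃ B, IsTestBound R B χ := by
  have h1 := χ.norm_le_seminorm ℂ
  have h2 := (SchwartzMap.derivCLM ℂ ℂ χ).norm_le_seminorm ℂ
  have h3 := (SchwartzMap.derivCLM ℂ ℂ (SchwartzMap.derivCLM ℂ ℂ χ)).norm_le_seminorm ℂ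
  exact ⟨max _ (max _ _), h, fun p => (h1 p).trans (le_max_left _ _),
    fun p => (h2 p).trans ((le_max_left _ _).trans (le_max_right _ _)),
    fun p => (h3 p).trans ((le_max_right _ _).trans (le_max_right _ _))⟩

theorem eq_zero_deriv_of_abs_gt {R : ℝ} {f : ℝ → ℂ} (h : ∀ p : ℝ, R < |p| → f p = 0) (p : ℝ)
    (hp : R < |p|) : deriv f p = 0 := by
  have : f =ᶠ[𝓝 p] fun _ => 0 := by
    filter_upwards [(isOpen_lt continuous_const continuous_abs).mem_nhds hp] with x hx
    exact h x hx
  rw [this.deriv_eq, deriv_const]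

namespace IsTestBound

variable {R B : ℝ} {χ : SchwartzMap ℝ ℂ}

theorem nonneg (h : IsTestBound R B χ) : 0 ≤ B := (norm_nonneg _).trans (h.norm_le 0)

/-- On the support the factor `p` costs `R`, and the Leibniz rule for `(pχ)'' = 2χ' + pχ''` costs at
most `2` more. The loss is a fixed factor, so iteration gives only geometric growth. -/
theorem mulVar (h : IsTestBound R B χ) (hR : 0 ≤ R) :
    IsTestBound R ((R + 2) * B) (mulVar χ) := by
  have hB := h.nonneg
  have d1 : deriv (_root_.mulVar χ) = fun p => χ p + p * deriv χ p := by
    funext p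
    have : (_root_.mulVar χ : ℝ → ℂ) = fun p : ℝ => (p : ℂ) * χ p := funext (mulVar_apply χ)
    rw [this]
    have := (Complex.ofRealCLM.hasDerivAt (x := p)).mul (χ.hasDerivAt p)
    refine (HasDerivAt.deriv this).trans ?_
    simp
  have d2 : deriv (deriv (_root_.mulVar χ)) = fun p => 2 * deriv χ p + p * deriv (deriv χ) p := by
    funext p
    rw [d1]
    have := (χ.hasDerivAt p).add ((Complex.ofRealCLM.hasDerivAt (x := p)).mul
      ((SchwartzMap.derivCLM ℂ ℂ χ).hasDerivAt p))
    refine (HasDerivAt.deriv this).trans ?_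
    simp only [Complex.ofRealCLM_apply, Complex.ofReal_one, one_mul]
    rw [← add_assoc, SchwartzMap.derivCLM_apply, ← two_mul]
    rfl
  have key : ∀ (f : ℝ → ℂ), (∀ p : ℝ, R < |p| → f p = 0) → (∀ p, ‖f p‖ ≤ B) →
      ∀ p : ℝ, ‖(p : ℂ) * f p‖ ≤ R * B := by
    intro f hf hfB p
    rcases lt_or_ge R |p| with hp | hp
    · rw [hf p hp, mul_zero, norm_zero]; positivity
    · rw [norm_mul, Complex.norm_real, Real.norm_eq_abs]
      exact mul_le_mul hp (hfB p) (norm_nonneg _) hR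
  have z1 := eq_zero_deriv_of_abs_gt h.eq_zero
  have z2 := eq_zero_deriv_of_abs_gt z1
  refine ⟨fun p hp => by rw [mulVar_apply, h.eq_zero p hp, mul_zero], fun p => ?_, fun p => ?_,
    fun p => ?_⟩
  · rw [mulVar_apply]
    linarith [key _ h.eq_zero h.norm_le p]
  · rw [d1]
    linarith [norm_add_le (χ p) (p * deriv χ p), key _ z1 h.norm_deriv_le p, h.norm_le p]
  · rw [d2]
    have := norm_add_le (2 * deriv χ p) (p * deriv (deriv χ) p)
    rw [norm_mul 2, Complex.norm_ofNat] at this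
    linarith [key _ z2 h.norm_deriv_deriv_le p, h.norm_deriv_le p]

theorem norm_angularFourier_le_of_support {f : SchwartzMap ℝ ℂ} (hR : 0 ≤ R)
    (hf : ∀ p : ℝ, R < |p| → f p = 0) (hB : ∀ p, ‖f p‖ ≤ B) (x : ℝ) :
    ‖angularFourier f x‖ ≤ 2 * R * B := by
  rw [angularFourier_apply]
  have h0 : ∀ p, p ∉ Icc (-R) R → f p * Complex.exp (-Complex.I * x * p) = 0 := by
    intro p hp
    rw [hf p (by rw [mem_Icc, ← abs_le] at hp; linarith), zero_mul]
  rw [← setIntegral_eq_integral_of_forall_compl_eq_zero h0]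
  refine (norm_setIntegral_le_of_norm_le_const (C := B) (by simp) fun p _ => ?_).trans_eq ?_
  · rw [norm_mul, show -Complex.I * x * p = ((-x * p : ℝ) : ℂ) * Complex.I by push_cast; ring,
      Complex.norm_exp_ofReal_mul_I, mul_one]
    exact hB p
  · rw [Real.volume_real_Icc_of_le (by linarith)]
    ring

/-- Two derivatives of `χ` bound `x²` times the transform; added to the bound without derivatives
this gives an integrable majorant, so bounded functions can be paired with it. -/
theorem norm_angularFourier_le (h : IsTestBound R B χ) (hR : 0 ≤ R) (x : ℝ) :
    ‖angularFourier χ x‖ ≤ 4 * R * B * (1 + x ^ 2)⁻¹ := by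
  have e1 := norm_angularFourier_le_of_support hR h.eq_zero h.norm_le x
  have e2 := norm_angularFourier_le_of_support
    (f := SchwartzMap.derivCLM ℂ ℂ (SchwartzMap.derivCLM ℂ ℂ χ)) hR
    (eq_zero_deriv_of_abs_gt (eq_zero_deriv_of_abs_gt h.eq_zero)) h.norm_deriv_deriv_le x
  rw [angularFourier_derivCLM, angularFourier_derivCLM, norm_mul, norm_mul, norm_mul (_ * _),
    norm_mul Complex.I,
    Complex.norm_I, Complex.norm_real, Real.norm_eq_abs, one_mul, ← mul_assoc, ← sq, sq_abs] at e2
  rw [← div_eq_mul_inv, le_div_iff₀ (by positivity)]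
  linarith

theorem norm_integral_mul_angularFourier_le (h : IsTestBound R B χ) (hR : 0 ≤ R) {f : ℝ → ℂ}
    {C : ℝ} (hf : ∀ x, ‖f x‖ ≤ C) :
    ‖∫ x, f x * angularFourier χ x‖ ≤ C * (4 * R * Real.pi) * B := by
  have hC : 0 ≤ C := (norm_nonneg _).trans (hf 0)
  refine (norm_integral_le_of_norm_le (integrable_inv_one_add_sq.const_mul (C * (4 * R * B)))
    (ae_of_all _ fun x => ?_)).trans_eq ?_
  · rw [norm_mul, mul_assoc]
    exact mul_le_mul (hf x) (h.norm_angularFourier_le hR x) (norm_nonneg _) hC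
  · rw [integral_const_mul, integral_univ_inv_one_add_sq]
    ring

end IsTestBound

/-! ### Uniqueness of the weak solution, tested on the frequency side. -/

/-- The pairing with `χ` of the frequency-side evolution `e^{-itp²} F(p)`. -/
def freePairing (F : ℝ → ℂ) (χ : SchwartzMap ℝ ℂ) (t : ℝ) : ℂ :=
  ∫ p : ℝ, F p * (Complex.exp (-Complex.I * (t * p ^ 2 : ℝ)) * χ p)

theorem norm_exp_neg_I_mul_ofReal (x : ℝ) : ‖Complex.exp (-Complex.I * (x : ℝ))‖ = 1 := by
  rw [show -Complex.I * (x : ℂ) = ((-x : ℝ) : ℂ) * Complex.I by push_cast; ring,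
    Complex.norm_exp_ofReal_mul_I]

theorem integrable_freePairing {F : ℝ → ℂ} (hF : Integrable F) (χ : SchwartzMap ℝ ℂ) (t : ℝ) :
    Integrable fun p : ℝ => F p * (Complex.exp (-Complex.I * (t * p ^ 2 : ℝ)) * χ p) := by
  refine hF.mul_bdd (c := SchwartzMap.seminorm ℂ 0 0 χ) ?_ (ae_of_all _ fun p => ?_)
  · exact (Continuous.mul (by fun_prop) χ.continuous).aestronglyMeasurable
  · rw [norm_mul, norm_exp_neg_I_mul_ofReal, one_mul]
    exact χ.norm_le_seminorm ℂ p

theorem norm_freePairing_le {F : ℝ → ℂ} (hF : Integrable F) {χ : SchwartzMap ℝ ℂ} {B : ℝ}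
    (h : ∀ p, ‖χ p‖ ≤ B) (t : ℝ) : ‖freePairing F χ t‖ ≤ (∫ p, ‖F p‖) * B := by
  rw [← integral_mul_const]
  refine norm_integral_le_of_norm_le (hF.norm.mul_const B) (ae_of_all _ fun p => ?_)
  rw [norm_mul, norm_mul, norm_exp_neg_I_mul_ofReal, one_mul]
  exact mul_le_mul_of_nonneg_left (h p) (norm_nonneg _)

theorem hasDerivAt_freePairing {F : ℝ → ℂ} (hF : Integrable F) (χ : SchwartzMap ℝ ℂ) (t : ℝ) :
    HasDerivAt (freePairing F χ) (-Complex.I * freePairing F (mulVar (mulVar χ)) t) t := by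
  have hd : ∀ p s : ℝ, HasDerivAt
      (fun s : ℝ => F p * (Complex.exp (-Complex.I * (s * p ^ 2 : ℝ)) * χ p))
      (-Complex.I * (F p * (Complex.exp (-Complex.I * (s * p ^ 2 : ℝ)) *
        mulVar (mulVar χ) p))) s := by
    intro p s
    have h1 := ((((hasDerivAt_id s).mul_const (p ^ 2)).ofReal_comp.const_mul
      (-Complex.I)).cexp.mul_const (χ p)).const_mul (F p)
    refine h1.congr_deriv ?_
    simp only [mulVar_apply, id]
    push_cast
    ring
  have h := (hasDerivAt_integral_of_dominated_loc_of_deriv_le (μ := volume)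
    (F := fun s p => F p * (Complex.exp (-Complex.I * (s * p ^ 2 : ℝ)) * χ p))
    (F' := fun s p => -Complex.I * (F p * (Complex.exp (-Complex.I * (s * p ^ 2 : ℝ)) *
        mulVar (mulVar χ) p)))
    (bound := fun p => ‖F p‖ * SchwartzMap.seminorm ℂ 0 0 (mulVar (mulVar χ)))
    (x₀ := t) (s := univ) univ_mem
    (Eventually.of_forall fun s => (integrable_freePairing hF χ s).aestronglyMeasurable)
    (integrable_freePairing hF χ t)
    ((integrable_freePairing hF (mulVar (mulVar χ)) t).aestronglyMeasurable.const_mul _)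
    (ae_of_all _ fun p s _ => ?_) (hF.norm.mul_const _) (ae_of_all _ fun p s _ => hd p s)).2
  · rw [integral_const_mul] at h
    exact h
  · rw [norm_mul, norm_neg, Complex.norm_I, one_mul, norm_mul, norm_mul,
      norm_exp_neg_I_mul_ofReal, one_mul]
    exact mul_le_mul_of_nonneg_left ((mulVar (mulVar χ)).norm_le_seminorm ℂ p) (norm_nonneg _)

namespace IsFreeSchrodingerSolution

variable {u₀ Fu₀ : ℝ → ℂ} {u : ℝ → ℝ → ℂ}

theorem continuous_apply (hu : IsFreeSchrodingerSolution u₀ u) {t : ℝ} (ht : 0 ≤ t) :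
    Continuous (u t) := by
  rw [← continuousOn_univ]
  exact hu.continuous.comp (f := fun x : ℝ => (t, x)) (by fun_prop) fun x hx => ⟨ht, hx⟩

/-- The defect between the solution and the evolution on the frequency side, tested against `χ`. -/
def defect (u : ℝ → ℝ → ℂ) (F : ℝ → ℂ) (χ : SchwartzMap ℝ ℂ) (t : ℝ) : ℂ :=
  (∫ x, u t x * angularFourier χ x) - freePairing F χ t

theorem hasDerivAt_defect (hu : IsFreeSchrodingerSolution u₀ u) (hF : Integrable Fu₀)
    (χ : SchwartzMap ℝ ℂ) {t : ℝ} (ht : 0 < t) :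
    HasDerivAt (defect u Fu₀ χ) (-Complex.I * defect u Fu₀ (mulVar (mulVar χ)) t) t := by
  refine ((hu.equation (angularFourier χ) t ht).sub (hasDerivAt_freePairing hF χ t)).congr_deriv ?_
  simp only [iteratedDeriv_two_angularFourier, mul_neg, integral_neg, defect]
  ring

theorem defect_zero (hu : IsFreeSchrodingerSolution u₀ u) (hF : IsFourierTransformOf Fu₀ u₀)
    (χ : SchwartzMap ℝ ℂ) : defect u Fu₀ χ 0 = 0 := by
  have h := (hF χ).2.2
  simp only [← angularFourier_apply] at h
  simp only [defect, freePairing, hu.initial, h, zero_mul, Complex.ofReal_zero, mul_zero,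
    Complex.exp_zero, one_mul, sub_self]

theorem continuousOn_defect (hu : IsFreeSchrodingerSolution u₀ u) (hF : Integrable Fu₀)
    (χ : SchwartzMap ℝ ℂ) (T : ℝ) : ContinuousOn (defect u Fu₀ χ) (Icc 0 T) := by
  obtain ⟨C, hC⟩ := hu.bounded T
  refine ContinuousOn.sub ?_ fun t _ =>
    (hasDerivAt_freePairing hF χ t).continuousAt.continuousWithinAt
  refine continuousOn_of_dominated (bound := fun x => C * ‖angularFourier χ x‖)
    (fun t ht => ((hu.continuous_apply ht.1).mul
      (angularFourier χ).continuous).aestronglyMeasurable)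
    (fun t ht => ae_of_all _ fun x => ?_) ((angularFourier χ).integrable.norm.const_mul C)
    (ae_of_all _ fun x => ?_)
  · rw [norm_mul]
    exact mul_le_mul_of_nonneg_right (hC t ht x) (norm_nonneg _)
  · refine ContinuousOn.mul ?_ continuousOn_const
    exact hu.continuous.comp (f := fun t : ℝ => (t, x)) (by fun_prop) fun t ht => ⟨ht.1, mem_univ _⟩

/-- The defect starts at zero and its derivative is, up to a unit factor, the defect for `p²χ`. Each
time integration costs `(R + 2)²` in the test bound and gains `t/n` in the iterated integral. The
induction must range over all `χ` and `B`. -/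
theorem norm_defect_le (hu : IsFreeSchrodingerSolution u₀ u) (hF : Integrable Fu₀)
    (hF₀ : IsFourierTransformOf Fu₀ u₀) {R C T : ℝ} (hR : 0 ≤ R)
    (hC : ∀ t ∈ Icc 0 T, ∀ x, ‖u t x‖ ≤ C) (n : ℕ) :
    ∀ {B : ℝ} {χ : SchwartzMap ℝ ℂ}, IsTestBound R B χ → ∀ t ∈ Icc 0 T,
      ‖defect u Fu₀ χ t‖ ≤ (C * (4 * R * Real.pi) + ∫ p, ‖Fu₀ p‖) * B *
        (((R + 2) ^ 2 * t) ^ n / n.factorial) := by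
  induction n with
  | zero =>
    intro B χ h t ht
    rw [pow_zero, Nat.factorial_zero, Nat.cast_one, div_one, mul_one, add_mul]
    exact (norm_sub_le _ _).trans (add_le_add
      (h.norm_integral_mul_angularFourier_le hR (hC t ht)) (norm_freePairing_le hF h.norm_le t))
  | succ n ih =>
    intro B χ h t ht
    have hsub : Icc 0 t ⊆ Icc 0 T := Icc_subset_Icc_right ht.2
    have hcont : ContinuousOn (fun s => -Complex.I * defect u Fu₀ (mulVar (mulVar χ)) s)
        (Icc 0 t) := continuousOn_const.mul ((hu.continuousOn_defect hF _ T).mono hsub)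
    have hftc := intervalIntegral.integral_eq_sub_of_hasDerivAt_of_le ht.1
      ((hu.continuousOn_defect hF χ T).mono hsub)
      (fun s hs => hu.hasDerivAt_defect hF χ hs.1)
      (ContinuousOn.intervalIntegrable (by rwa [uIcc_of_le ht.1]))
    rw [hu.defect_zero hF₀, sub_zero] at hftc
    have h2 := (h.mulVar hR).mulVar hR
    rw [← hftc]
    refine (intervalIntegral.norm_integral_le_of_norm_le ht.1
      (g := fun s => (C * (4 * R * Real.pi) + ∫ p, ‖Fu₀ p‖) * ((R + 2) * ((R + 2) * B)) *
        (((R + 2) ^ 2) ^ n / n.factorial) * s ^ n) (ae_of_all _ fun s hs => ?_)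
      (Continuous.intervalIntegrable (by fun_prop) _ _)).trans_eq ?_
    · rw [norm_mul, norm_neg, Complex.norm_I, one_mul]
      refine (ih h2 s (hsub ⟨hs.1.le, hs.2⟩)).trans_eq ?_
      rw [mul_pow]
      ring
    · rw [intervalIntegral.integral_const_mul, integral_pow, Nat.factorial_succ, zero_pow
        n.succ_ne_zero, sub_zero, mul_pow, pow_succ ((R + 2) ^ 2)]
      push_cast
      field_simp

theorem integral_mul_angularFourier_eq (hu : IsFreeSchrodingerSolution u₀ u)
    (hF : Integrable Fu₀) (hF₀ : IsFourierTransformOf Fu₀ u₀) {R : ℝ} (hR : 0 ≤ R)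
    {χ : SchwartzMap ℝ ℂ} (hχ : ∀ p : ℝ, R < |p| → χ p = 0) {t : ℝ} (ht : 0 ≤ t) :
    ∫ x, u t x * angularFourier χ x = freePairing Fu₀ χ t := by
  obtain ⟨C, hC⟩ := hu.bounded t
  obtain ⟨B, hB⟩ := exists_isTestBound R χ hχ
  have hlim := (FloorSemiring.tendsto_pow_div_factorial_atTop ((R + 2) ^ 2 * t)).const_mul
    ((C * (4 * R * Real.pi) + ∫ p, ‖Fu₀ p‖) * B)
  rw [mul_zero] at hlim
  have h := ge_of_tendsto' hlim fun n => hu.norm_defect_le hF hF₀ hR hC n hB t ⟨ht, le_rfl⟩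
  exact sub_eq_zero.1 (norm_le_zero_iff.1 h)

end IsFreeSchrodingerSolution

/-! ### Pointwise inversion by an approximate identity. -/

/-- A smooth compactly supported bump equal to `1` near the origin. -/
def unitBump : ContDiffBump (0 : ℝ) := ⟨1, 2, one_pos, one_lt_two⟩

/-- The modulated and dilated bump `p ↦ e^{ipx} η(p / l)`. -/
def modulatedBumpFun (x l p : ℝ) : ℂ := Complex.exp (Complex.I * x * p) * (unitBump (p / l) : ℝ)

theorem modulatedBumpFun_eq_zero {x l p : ℝ} (hl : 0 < l) (hp : 2 * l ≤ |p|) :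
    modulatedBumpFun x l p = 0 := by
  have : unitBump (p / l) = 0 := by
    refine unitBump.zero_of_le_dist ?_
    rw [dist_zero_right, Real.norm_eq_abs, abs_div, abs_of_pos hl, le_div_iff₀ hl]
    exact hp
  rw [modulatedBumpFun, this, Complex.ofReal_zero, mul_zero]

theorem contDiff_modulatedBumpFun (x l : ℝ) : ContDiff ℝ (⊤ : ℕ∞) (modulatedBumpFun x l) := by
  refine ContDiff.mul ?_ ?_
  · exact (contDiff_const.mul Complex.ofRealCLM.contDiff).cexp
  · exact Complex.ofRealCLM.contDiff.comp (unitBump.contDiff.comp (contDiff_id.div_const l))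

theorem hasCompactSupport_modulatedBumpFun (x : ℝ) {l : ℝ} (hl : 0 < l) :
    HasCompactSupport (modulatedBumpFun x l) := by
  refine HasCompactSupport.of_support_subset_isCompact (isCompact_closedBall (0 : ℝ) (2 * l)) ?_
  intro p hp
  rw [Metric.mem_closedBall, dist_zero_right, Real.norm_eq_abs]
  by_contra hc
  exact hp (modulatedBumpFun_eq_zero hl (not_le.1 hc).le)

/-- The modulated and dilated bump `p ↦ e^{ipx} η(p / l)` as a Schwartz function. -/
def modulatedBump (x : ℝ) {l : ℝ} (hl : 0 < l) : SchwartzMap ℝ ℂ :=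
  (hasCompactSupport_modulatedBumpFun x hl).toSchwartzMap (contDiff_modulatedBumpFun x l)

theorem modulatedBump_apply (x : ℝ) {l : ℝ} (hl : 0 < l) (p : ℝ) :
    modulatedBump x hl p = Complex.exp (Complex.I * x * p) * (unitBump (p / l) : ℝ) := rfl

/-- Modulation translates the transform to `x` and dilation concentrates it at scale `1 / l`. -/
theorem angularFourier_modulatedBump (x : ℝ) {l : ℝ} (hl : 0 < l) (y : ℝ) :
    angularFourier (modulatedBump x hl) (x + y / l) =
      l * angularFourier (modulatedBump 0 one_pos) y := by
  rw [angularFourier_apply, angularFourier_apply]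
  have h := Measure.integral_comp_div (fun p : ℝ => modulatedBump 0 one_pos p *
    Complex.exp (-Complex.I * y * p)) l
  rw [abs_of_pos hl, Complex.real_smul] at h
  rw [← h]
  refine integral_congr_ae (ae_of_all _ fun p => ?_)
  have hl' : (l : ℂ) ≠ 0 := Complex.ofReal_ne_zero.2 hl.ne'
  simp only [modulatedBump_apply, Complex.ofReal_zero, mul_zero, zero_mul, Complex.exp_zero,
    one_mul, div_one]
  rw [mul_comm (Complex.exp _), mul_assoc, ← Complex.exp_add]
  congr 2
  push_cast
  field_simp
  ring

theorem integral_mul_angularFourier_modulatedBump (f : ℝ → ℂ) (x : ℝ) {l : ℝ} (hl : 0 < l) :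
    ∫ y, f y * angularFourier (modulatedBump x hl) y =
      ∫ y, f (x + y / l) * angularFourier (modulatedBump 0 one_pos) y := by
  have h1 := integral_add_left_eq_self (μ := volume)
    (fun y => f y * angularFourier (modulatedBump x hl) y) x
  have h2 := Measure.integral_comp_div
    (fun y => f (x + y) * angularFourier (modulatedBump x hl) (x + y)) l
  rw [h1, abs_of_pos hl, Complex.real_smul] at h2
  have hl' : (l : ℂ) ≠ 0 := Complex.ofReal_ne_zero.2 hl.ne'
  refine mul_left_cancel₀ hl' (h2.symm.trans ?_)
  rw [← integral_const_mul]
  refine integral_congr_ae (ae_of_all _ fun y => ?_)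
  simp only [angularFourier_modulatedBump]
  ring

theorem integral_angularFourier (χ : SchwartzMap ℝ ℂ) :
    ∫ x, angularFourier χ x = 2 * Real.pi * χ 0 := by
  have h1 := Measure.integral_comp_mul_right (fun x : ℝ => 𝓕 (χ : ℝ → ℂ) x) (2 * Real.pi)⁻¹
  have h2 : ∫ x : ℝ, 𝓕 (χ : ℝ → ℂ) x = χ 0 := by
    have h3 : 𝓕⁻ (𝓕 (χ : ℝ → ℂ)) = χ :=
      χ.continuous.fourierInv_fourier_eq χ.integrable (𝓕 χ).integrable
    have h4 := congrFun h3 0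
    rw [Real.fourierInv_eq'] at h4
    simpa using h4
  simp only [angularFourier_eq_fourier]
  rw [h1, h2, inv_inv, abs_of_pos Real.two_pi_pos, Complex.real_smul]
  push_cast
  rfl

/-- The solution is the inverse Fourier transform of `e^{-itp²} 𝓕u₀(p)`. -/
theorem IsFreeSchrodingerSolution.eq_integral {u₀ Fu₀ : ℝ → ℂ} {u : ℝ → ℝ → ℂ}
    (hu : IsFreeSchrodingerSolution u₀ u) (hF : Integrable Fu₀)
    (hF₀ : IsFourierTransformOf Fu₀ u₀) {t : ℝ} (ht : 0 ≤ t) (x : ℝ) :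
    2 * Real.pi * u t x = ∫ p : ℝ, Fu₀ p * (Complex.exp (-Complex.I * (t * p ^ 2 : ℝ)) *
      Complex.exp (Complex.I * x * p)) := by
  obtain ⟨C, hC⟩ := hu.bounded t
  have hl : ∀ n : ℕ, (0 : ℝ) < n + 1 := fun n => n.cast_add_one_pos
  have hdiv : ∀ y : ℝ, Tendsto (fun n : ℕ => y / ((n : ℝ) + 1)) atTop (𝓝 0) := fun y => by
    simpa [div_eq_mul_inv] using (tendsto_one_div_add_atTop_nhds_zero_nat (𝕜 := ℝ)).const_mul y
  have hkey : ∀ n : ℕ, ∫ y, u t (x + y / ((n : ℝ) + 1)) *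
      angularFourier (modulatedBump 0 one_pos) y = freePairing Fu₀ (modulatedBump x (hl n)) t := by
    intro n
    rw [← integral_mul_angularFourier_modulatedBump (u t) x (hl n)]
    exact hu.integral_mul_angularFourier_eq hF hF₀ (R := 2 * (n + 1)) (by positivity)
      (fun p hp => modulatedBumpFun_eq_zero (hl n) hp.le) ht
  -- As the dilation grows, the left side tends to `u t x` times the mass `2π η(0) = 2π` of the
  -- kernel, and on the right the cutoff tends to `1`.
  have hlim1 : Tendsto (fun n : ℕ => ∫ y, u t (x + y / ((n : ℝ) + 1)) *
      angularFourier (modulatedBump 0 one_pos) y) atTop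
      (𝓝 (∫ y, u t x * angularFourier (modulatedBump 0 one_pos) y)) := by
    refine tendsto_integral_of_dominated_convergence
      (fun y => C * ‖angularFourier (modulatedBump 0 one_pos) y‖) (fun n => ?_)
      ((angularFourier _).integrable.norm.const_mul C) (fun n => ae_of_all _ fun y => ?_)
      (ae_of_all _ fun y => ?_)
    · exact (((hu.continuous_apply ht).comp (by fun_prop)).mul
        (angularFourier _).continuous).aestronglyMeasurable
    · rw [norm_mul]
      exact mul_le_mul_of_nonneg_right (hC t ⟨ht, le_rfl⟩ _) (norm_nonneg _)
    · refine Tendsto.mul_const _ (((hu.continuous_apply ht).tendsto x).comp ?_)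
      simpa using (hdiv y).const_add x
  have hlim2 : Tendsto (fun n : ℕ => freePairing Fu₀ (modulatedBump x (hl n)) t) atTop
      (𝓝 (∫ p : ℝ, Fu₀ p * (Complex.exp (-Complex.I * (t * p ^ 2 : ℝ)) *
        Complex.exp (Complex.I * x * p)))) := by
    refine tendsto_integral_of_dominated_convergence (fun p => ‖Fu₀ p‖)
      (fun n => (integrable_freePairing hF _ t).aestronglyMeasurable)
      hF.norm (fun n => ae_of_all _ fun p => ?_) (ae_of_all _ fun p => ?_)
    · rw [norm_mul, norm_mul, norm_exp_neg_I_mul_ofReal, one_mul, modulatedBump_apply, norm_mul,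
        show Complex.I * x * p = ((x * p : ℝ) : ℂ) * Complex.I by push_cast; ring,
        Complex.norm_exp_ofReal_mul_I, one_mul, Complex.norm_real,
        Real.norm_of_nonneg unitBump.nonneg]
      exact mul_le_of_le_one_right (norm_nonneg _) unitBump.le_one
    · refine Tendsto.const_mul _ (Tendsto.const_mul _ ?_)
      simp only [modulatedBump_apply]
      have h1 : unitBump 0 = 1 :=
        unitBump.one_of_mem_closedBall (Metric.mem_closedBall_self zero_le_one)
      have h2 : Tendsto (fun n : ℕ => ((unitBump (p / ((n : ℝ) + 1)) : ℝ) : ℂ)) atTop (𝓝 1) := by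
        have := (Complex.continuous_ofReal.tendsto _).comp
          ((unitBump.continuous.tendsto 0).comp (hdiv p))
        rwa [h1, Complex.ofReal_one] at this
      simpa using h2.const_mul (Complex.exp (Complex.I * x * p))
  have h := tendsto_nhds_unique hlim1 (hlim2.congr fun n => (hkey n).symm)
  rw [← h, integral_const_mul, integral_angularFourier, modulatedBump_apply,
    zero_div, unitBump.one_of_mem_closedBall (Metric.mem_closedBall_self zero_le_one)]
  simp [mul_comm]

/-! ### From the initial datum to the oscillatory integral. -/

/-- The derivative, relative to `[p₁, p₂]`, of the regular factor `v`, as a function of the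
distance to `p₁`. -/
def shiftedDeriv (p₁ p₂ : ℝ) (v : ℝ → ℂ) (q : ℝ) : ℂ := derivWithin v (Icc p₁ p₂) (p₁ + q)

theorem exists_isC1Amplitude {p₁ p₂ : ℝ} {v : ℝ → ℂ} (hp : p₁ < p₂)
    (hv : ContDiffOn ℝ 1 v (Icc p₁ p₂)) (h2 : v p₂ = 0) :
    ∃ M, IsC1Amplitude (p₂ - p₁) M (fun q => v (p₁ + q)) (shiftedDeriv p₁ p₂ v) := by
  have hmaps : MapsTo (fun q => p₁ + q) (Icc 0 (p₂ - p₁)) (Icc p₁ p₂) :=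
    fun q hq => ⟨by linarith [hq.1], by linarith [hq.2]⟩
  have hc : ContinuousOn (fun q => v (p₁ + q)) (Icc 0 (p₂ - p₁)) :=
    hv.continuousOn.comp (by fun_prop) hmaps
  have hc' : ContinuousOn (shiftedDeriv p₁ p₂ v) (Icc 0 (p₂ - p₁)) :=
    (hv.continuousOn_derivWithin (uniqueDiffOn_Icc hp) le_rfl).comp (by fun_prop) hmaps
  obtain ⟨M₁, hM₁⟩ := isCompact_Icc.exists_bound_of_continuousOn hc
  obtain ⟨M₂, hM₂⟩ := isCompact_Icc.exists_bound_of_continuousOn hc'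
  refine ⟨max M₁ M₂, hc, fun q hq => ?_, hc', fun q hq => (hM₁ q hq).trans (le_max_left _ _),
    fun q hq => (hM₂ q hq).trans (le_max_right _ _), by simpa using h2⟩
  have hq' : p₁ + q ∈ Ioo p₁ p₂ := ⟨by linarith [hq.1], by linarith [hq.2]⟩
  have hd := ((hv.differentiableOn one_ne_zero) (p₁ + q)
    (Ioo_subset_Icc_self hq')).hasDerivWithinAt.hasDerivAt (Icc_mem_nhds hq'.1 hq'.2)
  exact hd.comp_const_add p₁ q

namespace SingularFrequencyCondition

variable {p₁ p₂ μ : ℝ} {u₀ Fu₀ v : ℝ → ℂ}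

theorem regular_right_eq_zero (h : SingularFrequencyCondition p₁ p₂ μ u₀ Fu₀ v) (hp : p₁ < p₂) :
    v p₂ = 0 := by
  have h1 := h.amplitude p₂ ⟨hp, le_rfl⟩
  rw [h.right_eq_zero] at h1
  refine (mul_eq_zero.1 h1.symm).resolve_left ?_
  exact Complex.ofReal_ne_zero.2 (Real.rpow_pos_of_pos (sub_pos.2 hp) _).ne'

theorem integrable (h : SingularFrequencyCondition p₁ p₂ μ u₀ Fu₀ v) (hp : p₁ < p₂)
    (hμ : 0 < μ) : Integrable Fu₀ := by
  obtain ⟨M, hM⟩ := exists_isC1Amplitude hp h.regular (h.regular_right_eq_zero hp)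
  have h1 := (hM.intervalIntegrable_singularAmplitude_mul hμ (g := fun _ => 1)
    continuous_const le_rfl (sub_nonneg.2 hp.le) le_rfl).comp_sub_right p₁
  rw [zero_add, sub_add_cancel, intervalIntegrable_iff_integrableOn_Ioc_of_le hp.le] at h1
  rw [← integrableOn_iff_integrable_of_support_subset (s := Icc p₁ p₂)
    (fun p hp' => by_contra fun hc => hp' (h.support p hc)), integrableOn_Icc_iff_integrableOn_Ioc]
  refine h1.congr_fun (fun p hp' => ?_) measurableSet_Ioc
  simp only [singularAmplitude, mul_one, h.amplitude p hp', add_sub_cancel]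

theorem integral_mul_eq (h : SingularFrequencyCondition p₁ p₂ μ u₀ Fu₀ v) (hp : p₁ < p₂)
    (g : ℝ → ℂ) :
    ∫ p, Fu₀ p * g p =
      ∫ q in (0 : ℝ)..(p₂ - p₁), singularAmplitude μ (fun q => v (p₁ + q)) q * g (p₁ + q) := by
  have h0 : ∀ p, p ∉ Icc p₁ p₂ → Fu₀ p * g p = 0 := fun p hp' => by rw [h.support p hp', zero_mul]
  have h1 := intervalIntegral.integral_comp_sub_right (a := p₁) (b := p₂) (fun q =>
    singularAmplitude μ (fun q => v (p₁ + q)) q * g (p₁ + q)) p₁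
  rw [sub_self] at h1
  rw [← setIntegral_eq_integral_of_forall_compl_eq_zero h0, integral_Icc_eq_integral_Ioc, ← h1,
    intervalIntegral.integral_of_le hp.le]
  refine setIntegral_congr_fun measurableSet_Ioc fun p hp' => ?_
  simp only [singularAmplitude, h.amplitude p hp', add_sub_cancel]

/-- Completing the square: for `x = 2t(p₁ + s)` and `p = p₁ + q`, `-tp² + xp = t(p₁ + s)² - t(q -
s)²`. -/
theorem solution_eq (h : SingularFrequencyCondition p₁ p₂ μ u₀ Fu₀ v) (hp : p₁ < p₂)
    (hμ : 0 < μ) {u : ℝ → ℝ → ℂ} (hu : IsFreeSchrodingerSolution u₀ u) {t : ℝ} (ht : 0 ≤ t)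
    (s : ℝ) :
    2 * Real.pi * u t (2 * t * (p₁ + s)) = Complex.exp (Complex.I * (t * (p₁ + s) ^ 2 : ℝ)) *
      ∫ q in (0 : ℝ)..(p₂ - p₁), singularAmplitude μ (fun q => v (p₁ + q)) q *
        Complex.exp (-Complex.I * (t * (q - s) ^ 2 : ℝ)) := by
  rw [hu.eq_integral (h.integrable hp hμ) h.fourier ht, h.integral_mul_eq hp,
    ← intervalIntegral.integral_const_mul]
  refine intervalIntegral.integral_congr fun q _ => ?_
  rw [← Complex.exp_add, mul_left_comm (Complex.exp (Complex.I * _)), ← Complex.exp_add]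
  congr 2
  push_cast
  ring

theorem norm_solution_le (h : SingularFrequencyCondition p₁ p₂ μ u₀ Fu₀ v) (hp : p₁ < p₂)
    (hμ : 0 < μ) {u : ℝ → ℝ → ℂ} (hu : IsFreeSchrodingerSolution u₀ u) {t : ℝ} (ht : 0 ≤ t)
    (x : ℝ) : ‖u t x‖ ≤ ∫ p, ‖Fu₀ p‖ := by
  have h1 := hu.eq_integral (h.integrable hp hμ) h.fourier ht x
  have h2 : ‖2 * Real.pi * u t x‖ ≤ ∫ p, ‖Fu₀ p‖ := by
    rw [h1]
    refine norm_integral_le_of_norm_le (h.integrable hp hμ).norm (ae_of_all _ fun p => ?_)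
    rw [norm_mul, norm_mul, norm_exp_neg_I_mul_ofReal,
      show Complex.I * x * p = ((x * p : ℝ) : ℂ) * Complex.I by push_cast; ring,
      Complex.norm_exp_ofReal_mul_I, mul_one, mul_one]
  rw [norm_mul, norm_mul, Complex.norm_ofNat, Complex.norm_real,
    Real.norm_of_nonneg Real.pi_pos.le] at h2
  nlinarith [norm_nonneg (u t x), Real.pi_gt_three]

theorem norm_le_supNormOn (h : SingularFrequencyCondition p₁ p₂ μ u₀ Fu₀ v) {p : ℝ}
    (hp : p ∈ Icc p₁ p₂) : ‖v p‖ ≤ supNormOn p₁ p₂ v :=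
  le_csSup (isCompact_Icc.image_of_continuousOn h.regular.continuousOn.norm).bddAbove ⟨p, hp, rfl⟩

end SingularFrequencyCondition

/-! ### The coefficients and the two-term expansion on the curve. -/

theorem norm_exp_I_mul_ofReal (x : ℝ) : ‖Complex.exp (Complex.I * (x : ℝ))‖ = 1 := by
  rw [mul_comm, Complex.norm_exp_ofReal_mul_I]

theorem norm_coeffK {μ : ℝ} (hμ : 0 < μ) (p₁ ε : ℝ) (v : ℝ → ℂ) (t : ℝ) :
    ‖coeffK μ p₁ ε v t‖ = Real.Gamma μ / (2 ^ (μ + 1) * Real.pi) * ‖v p₁‖ := by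
  have := Real.Gamma_pos_of_pos hμ
  rw [coeffK, norm_mul, norm_mul, norm_mul, norm_exp_I_mul_ofReal, norm_exp_I_mul_ofReal,
    Complex.norm_real, Real.norm_of_nonneg (by positivity), mul_one, mul_one]

theorem norm_coeffH (p₁ p₂ ε : ℝ) (v : ℝ → ℂ) (t : ℝ) :
    ‖coeffH p₁ p₂ ε v t‖ =
      1 / (2 * √Real.pi) * ‖(Icc p₁ p₂).indicator v (p₁ + t ^ (-ε))‖ := by
  rw [coeffH, norm_mul, norm_mul, norm_mul, norm_exp_I_mul_ofReal, norm_exp_neg_I_mul_ofReal,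
    Complex.norm_real, Real.norm_of_nonneg (by positivity), mul_one, mul_one]

/-- The decay exponent of the error made near the stationary point. -/
def exponentStationary (μ ε : ℝ) : ℝ := 3 / 4 + ε * (μ - 3 / 2)

/-- The decay exponent of the error made near the singular frequency. -/
def exponentSingular (μ ε : ℝ) : ℝ := (μ + 1) / 2 - ε

theorem coeffH_eq {p₁ p₂ ε μ t : ℝ} (v : ℝ → ℂ) (ht : 0 < t) (hs : t ^ (-ε) ≤ p₂ - p₁) :
    2 * Real.pi * (coeffH p₁ p₂ ε v t * ((t ^ (-1 / 2 + ε * (1 - μ)) : ℝ) : ℂ)) =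
      Complex.exp (Complex.I * (t * (p₁ + t ^ (-ε)) ^ 2 : ℝ)) *
        (singularAmplitude μ (fun q => v (p₁ + q)) (t ^ (-ε)) * (2 * fresnelTail t 0)) := by
  have hs0 := Real.rpow_pos_of_pos ht (-ε)
  have hpow : t ^ (-1 / 2 + ε * (1 - μ)) = (t ^ (-ε)) ^ (μ - 1) * (√t)⁻¹ := by
    rw [← Real.rpow_mul ht.le, Real.sqrt_eq_rpow, ← Real.rpow_neg ht.le, ← Real.rpow_add ht]
    congr 1
    ring
  have hπ : 2 * Real.pi * (1 / (2 * √Real.pi)) = √Real.pi := by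
    have h5 : √Real.pi ≠ 0 := (Real.sqrt_pos.2 Real.pi_pos).ne'
    field_simp
    exact (Real.sq_sqrt Real.pi_pos.le).symm
  have hπ' := congrArg (fun x : ℝ => (x : ℂ)) hπ
  rw [coeffH, indicator_of_mem (show p₁ + t ^ (-ε) ∈ Icc p₁ p₂ from ⟨by linarith, by linarith⟩),
    fresnelTail_zero, hpow,
    singularAmplitude]
  simp only [Complex.ofReal_mul, Complex.ofReal_div, Complex.ofReal_inv,
    Complex.ofReal_ofNat] at hπ' ⊢
  linear_combination (Complex.exp (-Complex.I * ((Real.pi : ℂ) / 4)) *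
    Complex.exp (Complex.I * (t * ((p₁ + t ^ (-ε)) ^ 2 : ℝ))) * v (p₁ + t ^ (-ε)) *
    (((t ^ (-ε)) ^ (μ - 1) : ℝ) : ℂ) * ((√t : ℝ) : ℂ)⁻¹) * hπ'

theorem coeffK_eq {p₁ ε μ t : ℝ} (v : ℝ → ℂ) (hμ : 0 < μ) (ht : 0 < t) :
    2 * Real.pi * (coeffK μ p₁ ε v t * ((t ^ (-μ + ε * μ) : ℝ) : ℂ)) =
      Complex.exp (Complex.I * (t * (p₁ + t ^ (-ε)) ^ 2 : ℝ)) *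
        (Complex.exp (-Complex.I * (t * (t ^ (-ε)) ^ 2 : ℝ)) *
          (v (p₁ + 0) * (((2 * t * t ^ (-ε)) ^ (-μ) : ℝ) * oscGamma μ 0))) := by
  have hs0 := Real.rpow_pos_of_pos ht (-ε)
  have hpow : (2 * t * t ^ (-ε)) ^ (-μ) = 2 * (2 ^ (μ + 1))⁻¹ * t ^ (-μ + ε * μ) := by
    rw [mul_assoc, Real.mul_rpow zero_le_two (by positivity), Real.mul_rpow ht.le hs0.le,
      ← Real.rpow_mul ht.le, ← Real.rpow_add ht, Real.rpow_add zero_lt_two, Real.rpow_one,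
      Real.rpow_neg zero_le_two]
    have : (2 : ℝ) ^ μ ≠ 0 := (Real.rpow_pos_of_pos zero_lt_two _).ne'
    rw [neg_mul_neg]
    field_simp
  have hexp : Complex.exp (Complex.I * (t * (p₁ ^ 2 + 2 * p₁ * t ^ (-ε)) : ℝ)) =
      Complex.exp (Complex.I * (t * (p₁ + t ^ (-ε)) ^ 2 : ℝ)) *
        Complex.exp (-Complex.I * (t * (t ^ (-ε)) ^ 2 : ℝ)) := by
    rw [← Complex.exp_add]
    congr 1
    push_cast
    ring
  have hπ : (Real.pi : ℂ) ≠ 0 := Complex.ofReal_ne_zero.2 Real.pi_ne_zero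
  have h2 : (((2 : ℝ) ^ (μ + 1) : ℝ) : ℂ) ≠ 0 :=
    Complex.ofReal_ne_zero.2 (Real.rpow_pos_of_pos zero_lt_two _).ne'
  rw [coeffK, hexp, hpow, oscGamma_zero hμ, add_zero]
  simp only [Complex.ofReal_mul, Complex.ofReal_div, Complex.ofReal_inv, Complex.ofReal_ofNat]
  field_simp

variable {p₁ p₂ μ ε : ℝ} {u₀ Fu₀ v : ℝ → ℂ}

/-- Two-term expansion of the solution on the critical curve, for large times. -/
theorem SingularFrequencyCondition.exists_expansion_of_large
    (h : SingularFrequencyCondition p₁ p₂ μ u₀ Fu₀ v) (hp : p₁ < p₂) (h0 : 0 < μ) (h1 : μ < 1)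
    (hε : 0 < ε) (hε2 : ε < 1 / 2) :
    ∃ T C₁ C₂ : ℝ, 0 < T ∧ 0 ≤ C₁ ∧ 0 ≤ C₂ ∧ ∀ u, IsFreeSchrodingerSolution u₀ u →
      ∀ t ≥ T, ‖u t (2 * t * (p₁ + t ^ (-ε))) -
        (coeffK μ p₁ ε v t * ((t ^ (-μ + ε * μ) : ℝ) : ℂ) +
          coeffH p₁ p₂ ε v t * ((t ^ (-1 / 2 + ε * (1 - μ)) : ℝ) : ℂ))‖ ≤
        C₁ * t ^ (-exponentStationary μ ε) + C₂ * t ^ (-exponentSingular μ ε) := by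
  obtain ⟨M, hM⟩ := exists_isC1Amplitude hp h.regular (h.regular_right_eq_zero hp)
  have hL : 0 < p₂ - p₁ := sub_pos.2 hp
  have hM0 := hM.nonneg hL.le
  -- `ev1` is `2s ≤ L`, and `ev2` is `2σ ≤ s` divided by `s`, which needs `ε < 1/2`.
  have ev1 : ∀ᶠ t : ℝ in atTop, 2 * t ^ (-ε) ≤ p₂ - p₁ := by
    have := (tendsto_rpow_neg_atTop hε).const_mul 2
    rw [mul_zero] at this
    exact this.eventually_le_const hL
  have ev2 : ∀ᶠ t : ℝ in atTop, 2 * t ^ (-(1 / 2 - ε)) ≤ 1 := by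
    have := (tendsto_rpow_neg_atTop (show 0 < 1 / 2 - ε by linarith)).const_mul 2
    rw [mul_zero] at this
    exact this.eventually_le_const one_pos
  obtain ⟨T, hT⟩ := eventually_atTop.1 (ev1.and (ev2.and (eventually_ge_atTop 1)))
  have h1μ : 0 < 1 - μ := by linarith
  refine ⟨max T 1, M * (1 + (p₂ - p₁)) * (10 + 1 / (1 - μ)),
    M * (1 + (p₂ - p₁)) * (1 + 1 / (1 - μ)) + M * (1 + 3 / μ), by positivity, by positivity,
    by positivity, fun u hu t ht => ?_⟩
  obtain ⟨hs, hN, ht1⟩ := hT t ((le_max_left _ _).trans ht)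
  have ht0 : 0 < t := by linarith
  have hσ0 := Real.rpow_pos_of_pos ht0 (-(1 / 2))
  have hs0 := Real.rpow_pos_of_pos ht0 (-ε)
  have hσ2 : t * (t ^ (-(1 / 2) : ℝ)) ^ 2 = 1 := by
    rw [← Real.rpow_natCast, ← Real.rpow_mul ht0.le]
    norm_num
    rw [Real.rpow_neg_one, mul_inv_cancel₀ ht0.ne']
  have hσs : 2 * t ^ (-(1 / 2) : ℝ) ≤ t ^ (-ε) := by
    rw [show (-(1 / 2) : ℝ) = -(1 / 2 - ε) + -ε by ring, Real.rpow_add ht0]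
    nlinarith
  have hmain := hM.norm_integral_sub_le h0 h1 ht0 hσ0 hσ2
    (Real.rpow_le_one_of_one_le_of_nonpos ht1 (by norm_num)) hσs hs
  have e1 : t ^ (-(3 / 4) : ℝ) * (t ^ (-ε)) ^ (μ - 3 / 2) = t ^ (-exponentStationary μ ε) := by
    rw [← Real.rpow_mul ht0.le, ← Real.rpow_add ht0, exponentStationary]
    congr 1
    ring
  have e2 : (t ^ (-(1 / 2) : ℝ)) ^ (μ - 1) / (t * t ^ (-ε)) = t ^ (-exponentSingular μ ε) := by
    rw [← Real.rpow_mul ht0.le, exponentSingular, div_eq_mul_inv]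
    nth_rewrite 2 [← Real.rpow_one t]
    rw [← Real.rpow_add ht0, ← Real.rpow_neg ht0.le, ← Real.rpow_add ht0]
    congr 1
    ring
  rw [e1, e2] at hmain
  refine le_trans ?_ hmain
  have hsol := h.solution_eq hp h0 hu ht0.le (t ^ (-ε))
  have hH := coeffH_eq (p₁ := p₁) (p₂ := p₂) (μ := μ) v ht0 (by linarith : t ^ (-ε) ≤ p₂ - p₁)
  have hK := coeffK_eq (p₁ := p₁) (ε := ε) v h0 ht0
  have hdiff := congrArg norm (congrArg₂ (· - ·) hsol (congrArg₂ (· + ·) hK hH))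
  simp only [← mul_add, ← mul_sub] at hdiff
  rw [norm_mul, norm_mul, norm_mul, norm_exp_I_mul_ofReal, one_mul, Complex.norm_ofNat,
    Complex.norm_real, Real.norm_of_nonneg Real.pi_pos.le] at hdiff
  rw [← hdiff]
  exact le_mul_of_one_le_left (norm_nonneg _) (by linarith [Real.pi_gt_three])

theorem SingularFrequencyCondition.norm_coeffK_le
    (h : SingularFrequencyCondition p₁ p₂ μ u₀ Fu₀ v) (hp : p₁ < p₂) (h0 : 0 < μ) (t : ℝ) :
    ‖coeffK μ p₁ ε v t‖ ≤ boundK μ p₁ p₂ v := by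
  have := Real.Gamma_pos_of_pos h0
  rw [norm_coeffK h0, boundK]
  exact mul_le_mul_of_nonneg_left (h.norm_le_supNormOn ⟨le_rfl, hp.le⟩) (by positivity)

theorem SingularFrequencyCondition.norm_coeffH_le
    (h : SingularFrequencyCondition p₁ p₂ μ u₀ Fu₀ v) (hp : p₁ < p₂) (t : ℝ) :
    ‖coeffH p₁ p₂ ε v t‖ ≤ boundH p₁ p₂ v := by
  rw [norm_coeffH, boundH]
  refine mul_le_mul_of_nonneg_left ?_ (by positivity)
  by_cases hm : p₁ + t ^ (-ε) ∈ Icc p₁ p₂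
  · rw [indicator_of_mem hm]
    exact h.norm_le_supNormOn hm
  · rw [indicator_of_notMem hm, norm_zero]
    exact (norm_nonneg _).trans (h.norm_le_supNormOn ⟨le_rfl, hp.le⟩)

/-- Two-term expansion of the solution on the critical curve, away from the initial time. -/
theorem SingularFrequencyCondition.exists_expansion
    (h : SingularFrequencyCondition p₁ p₂ μ u₀ Fu₀ v) (hp : p₁ < p₂) (h0 : 0 < μ) (h1 : μ < 1)
    (hε : 0 < ε) (hε2 : ε < 1 / 2) {T₀ : ℝ} (hT₀ : 0 < T₀) :
    ∃ R₁ R₂ : ℝ, 0 ≤ R₁ ∧ 0 ≤ R₂ ∧ ∀ u, IsFreeSchrodingerSolution u₀ u →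
      ∀ t > T₀, ‖u t (2 * t * (p₁ + t ^ (-ε))) -
        (coeffK μ p₁ ε v t * ((t ^ (-μ + ε * μ) : ℝ) : ℂ) +
          coeffH p₁ p₂ ε v t * ((t ^ (-1 / 2 + ε * (1 - μ)) : ℝ) : ℂ))‖ ≤
        R₁ * t ^ (-exponentStationary μ ε) + R₂ * t ^ (-exponentSingular μ ε) := by
  obtain ⟨T, C₁, C₂, hT, hC₁, hC₂, hlarge⟩ := h.exists_expansion_of_large hp h0 h1 hε hε2
  have hα : 0 < exponentStationary μ ε := by rw [exponentStationary]; nlinarith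
  have hbK : 0 ≤ boundK μ p₁ p₂ v := (norm_nonneg _).trans (h.norm_coeffK_le (ε := ε) hp h0 0)
  have hbH : 0 ≤ boundH p₁ p₂ v := (norm_nonneg _).trans (h.norm_coeffH_le (ε := ε) hp 0)
  have hF : 0 ≤ ∫ p, ‖Fu₀ p‖ := integral_nonneg fun p => norm_nonneg _
  -- `D` bounds the whole left side for `t > T₀`. For `t < T`, `T^α t^(-α) ≥ 1` with `α =
  -- exponentStationary μ ε`, so the term `D T^α` in the first constant absorbs the bounded time
  -- range.
  set D := (∫ p, ‖Fu₀ p‖) + (boundK μ p₁ p₂ v * T₀ ^ (-μ + ε * μ) +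
    boundH p₁ p₂ v * T₀ ^ (-1 / 2 + ε * (1 - μ))) with hD
  have hD0 : 0 ≤ D := by positivity
  have hTα := Real.rpow_pos_of_pos hT (exponentStationary μ ε)
  refine ⟨C₁ + D * T ^ exponentStationary μ ε, C₂, by positivity, hC₂, fun u hu t ht => ?_⟩
  have ht0 : 0 < t := hT₀.trans ht
  have htα := Real.rpow_pos_of_pos ht0 (-exponentStationary μ ε)
  have htβ := Real.rpow_pos_of_pos ht0 (-exponentSingular μ ε)
  have hDT : 0 ≤ D * T ^ exponentStationary μ ε * t ^ (-exponentStationary μ ε) := by positivity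
  rcases le_or_gt T t with hTt | hTt
  · refine (hlarge u hu t hTt).trans ?_
    rw [add_mul]
    linarith
  · have hone : 1 ≤ T ^ exponentStationary μ ε * t ^ (-exponentStationary μ ε) := by
      rw [Real.rpow_neg ht0.le, ← div_eq_mul_inv, one_le_div (Real.rpow_pos_of_pos ht0 _)]
      exact Real.rpow_le_rpow ht0.le hTt.le hα.le
    have hb : ∀ {c : ℂ} {B r : ℝ}, r ≤ 0 → ‖c‖ ≤ B →
        ‖c * ((t ^ r : ℝ) : ℂ)‖ ≤ B * T₀ ^ r := by
      intro c B r hr hc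
      rw [norm_mul, Complex.norm_real, Real.norm_of_nonneg (Real.rpow_nonneg ht0.le _)]
      exact mul_le_mul hc (Real.rpow_le_rpow_of_nonpos hT₀ ht.le hr)
        (Real.rpow_nonneg ht0.le _) ((norm_nonneg _).trans hc)
    have hle : ‖u t (2 * t * (p₁ + t ^ (-ε))) -
        (coeffK μ p₁ ε v t * ((t ^ (-μ + ε * μ) : ℝ) : ℂ) +
          coeffH p₁ p₂ ε v t * ((t ^ (-1 / 2 + ε * (1 - μ)) : ℝ) : ℂ))‖ ≤ D :=
      (norm_sub_le _ _).trans (add_le_add (h.norm_solution_le hp h0 hu ht0.le _)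
        ((norm_add_le _ _).trans (add_le_add
          (hb (by nlinarith) (h.norm_coeffK_le hp h0 t))
          (hb (by nlinarith) (h.norm_coeffH_le hp t)))))
    have := le_mul_of_one_le_right hD0 hone
    have h3 : 0 ≤ C₁ * t ^ (-exponentStationary μ ε) := by positivity
    have h4 : 0 ≤ C₂ * t ^ (-exponentSingular μ ε) := by positivity
    rw [add_mul]
    linarith

theorem SingularFrequencyCondition.tendsto_norm_coeffH
    (h : SingularFrequencyCondition p₁ p₂ μ u₀ Fu₀ v) (hp : p₁ < p₂) (hε : 0 < ε) :
    Tendsto (fun t => ‖coeffH p₁ p₂ ε v t‖) atTop (𝓝 (1 / (2 * √Real.pi) * ‖v p₁‖)) := by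
  have hlim : Tendsto (fun t : ℝ => p₁ + t ^ (-ε)) atTop (𝓝 p₁) := by
    simpa using (tendsto_rpow_neg_atTop hε).const_add p₁
  have hmem : ∀ᶠ t : ℝ in atTop, p₁ + t ^ (-ε) ∈ Icc p₁ p₂ := by
    filter_upwards [hlim.eventually_le_const hp, eventually_ge_atTop 0] with t ht ht0
    exact ⟨le_add_of_nonneg_right (Real.rpow_nonneg ht0 _), ht⟩
  have hv := (h.regular.continuousOn p₁ ⟨le_rfl, hp.le⟩).tendsto.comp
    (tendsto_nhdsWithin_iff.2 ⟨hlim, hmem⟩)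
  refine (hv.norm.const_mul (1 / (2 * √Real.pi))).congr' ?_
  filter_upwards [hmem] with t ht
  rw [norm_coeffH, indicator_of_mem ht, Function.comp_apply]

/-! ### Lower bounds and the conclusion. -/

/-- A lower bound from a leading term `A t^a` whose coefficient dominates in the limit. -/
theorem exists_lower_bound {A B : ℝ → ℂ} {B₀ ℓ a b α β R₁ R₂ T₀ : ℝ} (hα : -α < a) (hβ : -β < a)
    (hB : ∀ t, ‖B t‖ ≤ B₀)
    (hlim : Tendsto (fun t => ‖A t‖ - B₀ * t ^ (b - a)) atTop (𝓝 ℓ)) (hℓ : 0 < ℓ) :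
    ∃ c T : ℝ, 0 < c ∧ ∀ t ≥ T, 0 < t ∧ T₀ < t ∧ ∀ z : ℂ,
      ‖z - (A t * ((t ^ a : ℝ) : ℂ) + B t * ((t ^ b : ℝ) : ℂ))‖ ≤
        R₁ * t ^ (-α) + R₂ * t ^ (-β) → c * t ^ a ≤ ‖z‖ := by
  have h1 := (tendsto_rpow_neg_atTop (show 0 < a + α by linarith)).const_mul R₁
  have h2 := (tendsto_rpow_neg_atTop (show 0 < a + β by linarith)).const_mul R₂
  have h3 := hlim.sub (h1.add h2)
  rw [mul_zero, mul_zero, add_zero, sub_zero] at h3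
  obtain ⟨T, hT⟩ := eventually_atTop.1 ((h3.eventually_const_lt (half_lt_self hℓ)).and
    ((eventually_gt_atTop 0).and (eventually_gt_atTop T₀)))
  refine ⟨ℓ / 2, T, half_pos hℓ, fun t ht => ?_⟩
  obtain ⟨hlow, ht0, htT⟩ := hT t ht
  refine ⟨ht0, htT, fun z hz => ?_⟩
  have hta := Real.rpow_pos_of_pos ht0 a
  have htb := Real.rpow_pos_of_pos ht0 b
  have e : ∀ r, t ^ r = t ^ a * t ^ (r - a) := fun r => by
    rw [← Real.rpow_add ht0]; congr 1; ring
  have n1 : ‖A t * ((t ^ a : ℝ) : ℂ)‖ = ‖A t‖ * t ^ a := by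
    rw [norm_mul, Complex.norm_real, Real.norm_of_nonneg hta.le]
  have n2 : ‖B t * ((t ^ b : ℝ) : ℂ)‖ ≤ B₀ * (t ^ a * t ^ (b - a)) := by
    rw [norm_mul, Complex.norm_real, Real.norm_of_nonneg htb.le, ← e]
    exact mul_le_mul_of_nonneg_right (hB t) htb.le
  rw [e (-α), e (-β), show -α - a = -(a + α) by ring, show -β - a = -(a + β) by ring] at hz
  have n3 : ‖A t * ((t ^ a : ℝ) : ℂ)‖ ≤
      ‖z‖ + ‖B t * ((t ^ b : ℝ) : ℂ)‖ +
        ‖z - (A t * ((t ^ a : ℝ) : ℂ) + B t * ((t ^ b : ℝ) : ℂ))‖ := by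
    have := norm_sub_le (z - B t * ((t ^ b : ℝ) : ℂ))
      (z - (A t * ((t ^ a : ℝ) : ℂ) + B t * ((t ^ b : ℝ) : ℂ)))
    rw [show z - B t * ((t ^ b : ℝ) : ℂ) -
      (z - (A t * ((t ^ a : ℝ) : ℂ) + B t * ((t ^ b : ℝ) : ℂ))) = A t * ((t ^ a : ℝ) : ℂ) by ring]
      at this
    linarith [norm_sub_le z (B t * ((t ^ b : ℝ) : ℂ))]
  have := mul_lt_mul_of_pos_right hlow hta
  linarith

theorem eq_of_mem_criticalCurve {t x : ℝ} (h : (t, x) ∈ criticalCurve ε p₁) :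
    0 < t ∧ x = 2 * t * (p₁ + t ^ (-ε)) := by
  obtain ⟨ht, hx⟩ := h
  simp only at ht hx
  refine ⟨ht, ?_⟩
  rw [← hx]
  field_simp
  ring

/-- Excludes cancellation at `μ = 1/2`: since `Γ(1/2) = √π`, the claim reduces to `2 < 2^(3/2)`. -/
theorem boundK_half_lt_boundH {x : ℝ} (hx : 0 < x) :
    Real.Gamma (1 / 2) / (2 ^ ((1 : ℝ) / 2 + 1) * Real.pi) * x < 1 / (2 * √Real.pi) * x := by
  refine mul_lt_mul_of_pos_right ?_ hx
  have hπ := Real.sqrt_pos.2 Real.pi_pos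
  have h2 : (2 : ℝ) < 2 ^ ((1 : ℝ) / 2 + 1) := by
    nth_rewrite 1 [← Real.rpow_one 2]
    exact Real.rpow_lt_rpow_of_exponent_lt one_lt_two (by norm_num)
  rw [Real.Gamma_one_half_eq, div_lt_div_iff₀ (by positivity) (by positivity), one_mul]
  calc √Real.pi * (2 * √Real.pi) = 2 * Real.pi := by
        rw [mul_left_comm, Real.mul_self_sqrt Real.pi_pos.le]
    _ < _ := mul_lt_mul_of_pos_right h2 Real.pi_pos

end

theorem theorem3p4 (μ δ ε : ℝ) (hμ : μ ∈ Set.Ioo (0 : ℝ) 1)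
    (hδ : δ ∈ Set.Ico ((μ + 1) / 2) 1) (hε : ε ∈ Set.Ioo 0 (δ - 1 / 2)) :
    ∃ α β : ℝ,
      -- the remainders decay strictly faster than the leading term
      (1 / 2 < μ → -α < -1 / 2 + ε * (1 - μ) ∧ -β < -1 / 2 + ε * (1 - μ) ∧
        -μ + ε * μ < -1 / 2 + ε * (1 - μ)) ∧
      (μ = 1 / 2 → -α < -1 / 2 + ε / 2 ∧ -β < -1 / 2 + ε / 2) ∧
      (μ < 1 / 2 → -α < -μ + ε * μ ∧ -β < -μ + ε * μ ∧
        -1 / 2 + ε * (1 - μ) < -μ + ε * μ) ∧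
      ∀ p₁ p₂ : ℝ, p₁ < p₂ → ∀ u₀ Fu₀ v : ℝ → ℂ,
        SingularFrequencyCondition p₁ p₂ μ u₀ Fu₀ v →
        ∃ R₁ R₂ c T' : ℝ, 0 ≤ R₁ ∧ 0 ≤ R₂ ∧ 0 < c ∧
          ∀ u : ℝ → ℝ → ℂ, IsFreeSchrodingerSolution u₀ u →
            -- expansion on the curve
            (∀ t x : ℝ, (t, x) ∈ criticalCurve ε p₁ → timeThreshold ε p₁ p₂ < t →
              ‖coeffK μ p₁ ε v t‖ ≤ boundK μ p₁ p₂ v ∧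
              ‖coeffH p₁ p₂ ε v t‖ ≤ boundH p₁ p₂ v ∧
              (1 / 2 < μ →
                ‖u t x - coeffH p₁ p₂ ε v t * ((t ^ (-1 / 2 + ε * (1 - μ)) : ℝ) : ℂ)‖ ≤
                  boundK μ p₁ p₂ v * t ^ (-μ + ε * μ) + R₁ * t ^ (-α) + R₂ * t ^ (-β)) ∧
              (μ = 1 / 2 →
                ‖u t x - (coeffK μ p₁ ε v t + coeffH p₁ p₂ ε v t) *
                    ((t ^ (-1 / 2 + ε / 2) : ℝ) : ℂ)‖ ≤
                  R₁ * t ^ (-α) + R₂ * t ^ (-β)) ∧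
              (μ < 1 / 2 →
                ‖u t x - coeffK μ p₁ ε v t * ((t ^ (-μ + ε * μ) : ℝ) : ℂ)‖ ≤
                  boundH p₁ p₂ v * t ^ (-1 / 2 + ε * (1 - μ)) + R₁ * t ^ (-α) +
                    R₂ * t ^ (-β))) ∧
            -- the rate of the leading term is attained on the curve
            (∀ t x : ℝ, (t, x) ∈ criticalCurve ε p₁ → T' ≤ t →
              (1 / 2 < μ → c * t ^ (-1 / 2 + ε * (1 - μ)) ≤ ‖u t x‖) ∧
              (μ = 1 / 2 → c * t ^ (-1 / 2 + ε / 2) ≤ ‖u t x‖) ∧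
              (μ < 1 / 2 → c * t ^ (-μ + ε * μ) ≤ ‖u t x‖)) := by
  obtain ⟨h0, h1⟩ := hμ
  have hε0 : 0 < ε := hε.1
  have hε2 : ε < 1 / 2 := by linarith [hε.2, hδ.2]
  -- Every exponent gap below is a positive multiple of `1 - 2ε`: `1/4`, `μ/2`, `(1-μ)/2` and `|μ -
  -- 1/2|` times it, in this order.
  have hN : 0 < 1 - 2 * ε := by linarith
  have hαH : -exponentStationary μ ε < -1 / 2 + ε * (1 - μ) := by
    rw [exponentStationary]; linarith
  have hβH : -exponentSingular μ ε < -1 / 2 + ε * (1 - μ) := by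
    rw [exponentSingular]; nlinarith
  have hβK : -exponentSingular μ ε < -μ + ε * μ := by
    rw [exponentSingular]; nlinarith
  have hKH : 1 / 2 < μ → -μ + ε * μ < -1 / 2 + ε * (1 - μ) := fun h => by nlinarith
  have hHK : μ < 1 / 2 → -1 / 2 + ε * (1 - μ) < -μ + ε * μ := fun h => by nlinarith
  refine ⟨exponentStationary μ ε, exponentSingular μ ε, fun h => ⟨hαH, hβH, hKH h⟩,
    fun h => ?_, fun h => ⟨hαH.trans (hHK h), hβK, hHK h⟩, ?_⟩
  · have e : -1 / 2 + ε / 2 = -1 / 2 + ε * (1 - μ) := by rw [h]; ring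
    rw [e]
    exact ⟨hαH, hβH⟩
  intro p₁ p₂ hp u₀ Fu₀ v hv
  have hT₀ : 0 < timeThreshold ε p₁ p₂ :=
    Real.rpow_pos_of_pos (mul_pos two_pos (sub_pos.2 hp)) _
  obtain ⟨R₁, R₂, hR₁, hR₂, hexp⟩ := hv.exists_expansion hp h0 h1 hε0 hε2 hT₀
  have hvpos : 0 < ‖v p₁‖ := norm_pos_iff.2 hv.left_ne_zero
  have hη : 0 < 1 / (2 * √Real.pi) * ‖v p₁‖ := by
    have := Real.sqrt_pos.2 Real.pi_pos
    positivity
  have hlower : ∃ c T' : ℝ, 0 < c ∧ ∀ u, IsFreeSchrodingerSolution u₀ u → ∀ t x : ℝ,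
      (t, x) ∈ criticalCurve ε p₁ → T' ≤ t →
        (1 / 2 < μ → c * t ^ (-1 / 2 + ε * (1 - μ)) ≤ ‖u t x‖) ∧
        (μ = 1 / 2 → c * t ^ (-1 / 2 + ε / 2) ≤ ‖u t x‖) ∧
        (μ < 1 / 2 → c * t ^ (-μ + ε * μ) ≤ ‖u t x‖) := by
    -- For `μ < 1/2` the `K` term leads. For `μ ≥ 1/2` the `H` term does; at equality the exponent
    -- difference is `0`, and the limit is the gap between the two moduli.
    rcases lt_or_ge μ (1 / 2) with hμ | hμ
    · have hlim : Filter.Tendsto (fun t : ℝ => ‖coeffK μ p₁ ε v t‖ -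
          boundH p₁ p₂ v * t ^ (-1 / 2 + ε * (1 - μ) - (-μ + ε * μ))) Filter.atTop
          (nhds (Real.Gamma μ / (2 ^ (μ + 1) * Real.pi) * ‖v p₁‖)) := by
        simp only [norm_coeffK h0]
        have := (tendsto_rpow_neg_atTop (sub_pos.2 (hHK hμ))).const_mul (boundH p₁ p₂ v)
        rw [mul_zero, neg_sub] at this
        simpa using this.const_sub (Real.Gamma μ / (2 ^ (μ + 1) * Real.pi) * ‖v p₁‖)
      have hκ : 0 < Real.Gamma μ / (2 ^ (μ + 1) * Real.pi) * ‖v p₁‖ := by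
        have := Real.Gamma_pos_of_pos h0
        have := Real.pi_pos
        positivity
      obtain ⟨c, T', hc, hlow⟩ := exists_lower_bound (R₁ := R₁) (R₂ := R₂)
        (T₀ := timeThreshold ε p₁ p₂) (hαH.trans (hHK hμ)) hβK
        (fun t => hv.norm_coeffH_le hp t) hlim hκ
      refine ⟨c, T', hc, fun u hu t x hx ht => ⟨fun h => by linarith, fun h => by linarith,
        fun _ => ?_⟩⟩
      obtain ⟨-, htT, hz⟩ := hlow t ht
      obtain ⟨-, rfl⟩ := eq_of_mem_criticalCurve hx
      exact hz _ (hexp u hu t htT)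
    · have hlim : ∃ ℓ > 0, Filter.Tendsto (fun t : ℝ => ‖coeffH p₁ p₂ ε v t‖ -
          Real.Gamma μ / (2 ^ (μ + 1) * Real.pi) * ‖v p₁‖ *
            t ^ (-μ + ε * μ - (-1 / 2 + ε * (1 - μ)))) Filter.atTop (nhds ℓ) := by
        rcases hμ.eq_or_lt with hμ | hμ
        · subst hμ
          refine ⟨_, sub_pos.2 (boundK_half_lt_boundH hvpos),
            (hv.tendsto_norm_coeffH hp hε0).sub ?_⟩
          have e : -(1 / 2) + ε * (1 / 2) - (-1 / 2 + ε * (1 - 1 / 2)) = 0 := by ring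
          simp only [e, Real.rpow_zero, mul_one]
          exact tendsto_const_nhds
        · refine ⟨_, hη, ?_⟩
          have := (tendsto_rpow_neg_atTop (sub_pos.2 (hKH hμ))).const_mul
            (Real.Gamma μ / (2 ^ (μ + 1) * Real.pi) * ‖v p₁‖)
          rw [mul_zero, neg_sub] at this
          simpa using (hv.tendsto_norm_coeffH hp hε0).sub this
      obtain ⟨ℓ, hℓ, hlim⟩ := hlim
      obtain ⟨c, T', hc, hlow⟩ := exists_lower_bound (R₁ := R₁) (R₂ := R₂)
        (T₀ := timeThreshold ε p₁ p₂) hαH hβH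
        (fun t => (norm_coeffK (ε := ε) h0 p₁ v t).le) hlim hℓ
      have hall : ∀ u, IsFreeSchrodingerSolution u₀ u → ∀ t x : ℝ,
          (t, x) ∈ criticalCurve ε p₁ → T' ≤ t →
            c * t ^ (-1 / 2 + ε * (1 - μ)) ≤ ‖u t x‖ := by
        intro u hu t x hx ht
        obtain ⟨-, htT, hz⟩ := hlow t ht
        obtain ⟨-, rfl⟩ := eq_of_mem_criticalCurve hx
        have := hexp u hu t htT
        rw [add_comm (coeffK μ p₁ ε v t * _)] at this
        exact hz _ this
      refine ⟨c, T', hc, fun u hu t x hx ht => ⟨fun _ => hall u hu t x hx ht, fun h => ?_,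
        fun h => absurd h (not_lt.2 hμ)⟩⟩
      have e : -1 / 2 + ε / 2 = -1 / 2 + ε * (1 - μ) := by rw [h]; ring
      rw [e]
      exact hall u hu t x hx ht
  obtain ⟨c, T', hc, hlow⟩ := hlower
  refine ⟨R₁, R₂, c, T', hR₁, hR₂, hc, fun u hu => ⟨fun t x hx htT => ?_, hlow u hu⟩⟩
  obtain ⟨ht, rfl⟩ := eq_of_mem_criticalCurve hx
  have hK := hv.norm_coeffK_le (ε := ε) hp h0 t
  have hH := hv.norm_coeffH_le (ε := ε) hp t
  have hE := hexp u hu t htT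
  have term : ∀ {k : ℂ} {b r : ℝ}, ‖k‖ ≤ b → ‖k * ((t ^ r : ℝ) : ℂ)‖ ≤ b * t ^ r := by
    intro k b r hk
    have htr := Real.rpow_nonneg ht.le r
    rw [norm_mul, Complex.norm_real, Real.norm_of_nonneg htr]
    exact mul_le_mul_of_nonneg_right hk htr
  have split : ∀ {z k h : ℂ} {b e : ℝ}, ‖z - (k + h)‖ ≤ e → ‖k‖ ≤ b → ‖z - h‖ ≤ b + e := by
    intro z k h b e h1 h2
    rw [show z - h = k + (z - (k + h)) by ring]
    exact (norm_add_le _ _).trans (add_le_add h2 h1)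
  refine ⟨hK, hH, fun _ => ?_, fun h => ?_, fun _ => ?_⟩
  · rw [add_assoc]
    exact split hE (term hK)
  · have e1 : -1 / 2 + ε / 2 = -1 / 2 + ε * (1 - μ) := by rw [h]; ring
    have e2 : -μ + ε * μ = -1 / 2 + ε * (1 - μ) := by rw [h]; ring
    rw [e1, add_mul]
    rwa [e2] at hE
  · rw [add_assoc]
    rw [add_comm (coeffK μ p₁ ε v t * _)] at hE
    exact split hE (term hH)
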